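/- **Setting.** A (finite-horizon) Dec-POMDP $D$ consists of agents $\mathcal N=\{1,\dots,N\}$, finite sets of states $\mathcal S$, actions $\mathcal A_i\neq\emptyset$ and observations $\mathcal O_i$ ($i\in\mathcal N$), with $\mathcal A=\prod_i\mathcal A_i$, $\mathcal O=\prod_i\mathcal O_i$, kernels $P(\cdot\mid s,a)\in\Delta(\mathcal S)$ and $O(\cdot\mid s,a)\in\Delta(\mathcal O)$, a reward $\mathcal R:\mathcal S\times\mathcal A\to\mathbb R$, an initial distribution $b_0\in\Delta(\mathcal S)$ and a horizon $T\in\mathbb N_0$. A local policy of agent $i$ maps each local history $\tau_{i,t}\in(\mathcal A_i\times\mathcal O_i)^t$, $0\le t\le T$, to a distribution $\pi_i(\cdot\mid\tau_{i,t})\in\Delta(\mathcal A_i)$; $\Pi^D=\prod_i\Pi^D_i$ is the set of joint policies, with its Borel $\sigma$-algebra. Under $\mathbb P_\pi$: $S_0\sim b_0$, the agents independently draw $A_{i,t}\sim\pi_i(\cdot\mid \overline{AO}_{i,t})$ with $\overline{AO}_{i,t}=(A_{i,0},O_{i,1},\dots,A_{i,t-1},O_{i,t})$, $S_{t+1}\sim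 P(\cdot\mid S_t,A_t)$, $O_{t+1}\sim O(\cdot\mid S_{t+1},A_t)$; and $J^D(\pi)=\mathbb E_\pi\big[\sum_{t=0}^T\mathcal R(S_t,A_t)\big]$. An isomorphism $f\in\mathrm{Iso}(D,E)$ (for $T^D=T^E$) is a tuple of bijections $f_N:\mathcal N^D\to\mathcal N^E$, $f_S:\mathcal S^D\to\mathcal S^E$, $f_{A_i}:\mathcal A^D_i\to\mathcal A^E_{f_N(i)}$, $f_{O_i}:\mathcal O^D_i\to\mathcal O^E_{f_N(i)}$ that preserves $P,O,\mathcal R,b_0$; $\mathrm{Aut}(D)=\mathrm{Iso}(D,D)$. The pushforward $f^*\pi\in\Pi^E$ of $\pi\in\Pi^D$ is $(f^*\pi)_j(a_j\mid\tau_{j,t})=\pi_{f^{-1}j}(f^{-1}a_j\mid f^{-1}\tau_{j,t})$, and $f^*\nu=\nu\circ(f^*)^{-1}$ for a probability measure $\nu$ on $\Pi^D$. For $\mathbf g\in\mathrm{Aut}(D)^{\mathcal N}$ put $\mathbf g^*\pi=((\mathbf g_i^*\pi)_i)_{i\in\mathcal N}$. The other-play (OP) objective is $J^D_{\mathrm{OP}}(\pi)=|\mathrm{Aut}(D)|^{-N}\sum_{\mathbf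 g\in\mathrm{Aut}(D)^{\mathcal N}}J^D(\mathbf g^*\pi)$, and $\Pi^D_{\mathrm{OP}}=\arg\max_{\pi\in\Pi^D}J^D_{\mathrm{OP}}(\pi)$. The symmetrizer $\Psi^D:\Pi^D\to\Pi^D$ is defined as follows. Let $\mu=|\mathrm{Aut}(D)|^{-N}\sum_{\mathbf g}\delta_{\mathbf g^*\pi}$ with marginals $\mu_i$ on $\Pi^D_i$. Then $\Psi^D(\pi)_i(a_i\mid\tau_{i,t})=\mathbb P_{\mu_i\otimes\mu_{-i}}(A_{i,t}=a_i\mid\overline{AO}_{i,t}=\tau_{i,t})$, where $\mu_{-i}$ is any product of probability measures on the $\Pi^D_j$, $j\ne i$, for which the conditioning event has positive probability (the value does not depend on the choice), and $\Psi^D(\pi)_i(\cdot\mid\tau_{i,t})$ is uniform if there is none; here $\mathbb P_{\mu_i\otimes\mu_{-i}}$ means that a joint policy is first drawn from $\mu_i\otimes\mu_{-i}$ and then followed. Write $\pi\equiv_D\pi'$ if $\Psi^D(\pi)=\Psi^D(\pi')$, $[\pi]$ for the class of $\pi$, and $f^*[\pi]=[f^*\pi]$. A labeling of $D$ is a tuple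 $f$ of bijections $\mathcal N\to\{1,\dots,N\}$, $\mathcal S\to\{1,\dots,|\mathcal S|\}$, $\mathcal A_i\to\{1,\dots,|\mathcal A_i|\}$, $\mathcal O_i\to\{1,\dots,|\mathcal O_i|\}$ ($i\in\mathcal N$), and $f^*D$ is the Dec-POMDP obtained by transporting $D$ along $f$. Let $\mathcal D$ be the finite set of all $f^*D$. A learning algorithm $\sigma\in\Sigma^{\mathcal D}$ assigns to each $E\in\mathcal D$ a probability measure $\sigma(E)$ on $\Pi^E$. The label-free coordination (LFC) game for $D$ has players (principals) $\mathcal N$, strategies $\Sigma^{\mathcal D}$ and common payoff $$U(\boldsymbol\sigma_1,\dots,\boldsymbol\sigma_N)=\mathbb E_{D_i\sim\mathcal U(\mathcal D),\,i\in\mathcal N}\Big[\mathbb E_{f_j\sim\mathcal U(\mathrm{Iso}(D_j,D)),\,j\in\mathcal N}\Big[\mathbb E_{\pi^{(k)}\sim f_k^*\boldsymbol\sigma_k(D_k),\,k\in\mathcal N}\big[J^D\big((\pi^{(l)}_l)_{l\in\mathcal N}\big)\big]\Big]\Big],$$ all draws independent and $\mathcal U$ uniform. Put $U(\sigma)=U(\sigma,\dots,\sigma)$;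 $\sigma$ is optimal in the LFC problem for $D$ if $U(\sigma)\ge U(\sigma')$ for all $\sigma'\in\Sigma^{\mathcal D}$. A profile is symmetric if $\boldsymbol\sigma_i=\boldsymbol\sigma_{g^{-1}i}$ for all $g\in\mathrm{Aut}(D)$, $i\in\mathcal N$, and an optimal symmetric profile is a symmetric profile whose payoff is at least that of every symmetric profile. A tie-breaking function for $\mathcal D$ is a map $\chi$ assigning to each $E\in\mathcal D$ and $\pi\in\Pi^E$ a value $\chi(E,\pi)\in[0,1]$ such that for every $E\in\mathcal D$: (i) $\chi(E,\cdot)$ attains a maximum on $\Pi^E_{\mathrm{OP}}$; (ii) for all $\pi,\pi'\in\Pi^E$, $\chi(E,\pi)=\chi(E,\pi')$ implies $\pi\equiv_E\pi'$. It is invariant to isomorphism if for all $E,F\in\mathcal D$, $f\in\mathrm{Iso}(E,F)$, $\pi\in\Pi^E$, $\pi'\in\Pi^F$, $f^*[\pi]=[\pi']$ implies $\chi(E,\pi)=\chi(F,\pi')$. An OP with tie-breaking learning algorithm for $\chi$ is a $\sigma^\chi\in\Sigma^{\mathcal D}$ such that for every $E\in\mathcal D$ there is a measurable set $\mathcal Z\subseteq\arg\max_{\pi\in\Pi^E_{\mathrm{OP}}}\chi(E,\pi)$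 with $\sigma^\chi(E)(\mathcal Z)=1$. **Theorem.** Let $D$ be a Dec-POMDP, $\chi$ a tie-breaking function for $\mathcal D$ that is invariant to isomorphism, and $\sigma^\chi$ an OP with tie-breaking learning algorithm for $\chi$. Then the profile $(\sigma^\chi,\dots,\sigma^\chi)$ is an optimal symmetric profile in the LFC game for $D$. In particular, $\sigma^\chi$ is optimal in the LFC problem for $D$, and $$U(\sigma^\chi)=\max_{\sigma\in\Sigma^{\mathcal D}}U(\sigma)=\max_{\pi\in\Pi^D}J^D_{\mathrm{OP}}(\pi),$$ where both maxima are attained. -/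

import Mathlib

open MeasureTheory
open scoped BigOperators ENNReal

universe u v

/-- A finite-horizon Dec-POMDP. `Fin N` is the set of agents, joint actions and joint observations
are tuples indexed by the agents, `stdSimplex ℝ X` is the set of probability mass functions on the
finite set `X`, and `T` is the horizon (steps are `0, …, T`). -/
structure DecPOMDP : Type (u + 1) where
  N : ℕ
  State : Type u
  [stateFintype : Fintype State]
  Act : Fin N → Type u
  [actFintype : ∀ i, Fintype (Act i)]
  [actNonempty : ∀ i, Nonempty (Act i)]
  Obs : Fin N → Type u
  [obsFintype : ∀ i, Fintype (Obs i)]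
  /-- Transition kernel `P(· ∣ s, a)`. -/
  P : State → (∀ i, Act i) → stdSimplex ℝ State
  /-- Joint reward. -/
  R : State → (∀ i, Act i) → ℝ
  /-- Observation kernel `O(· ∣ s, a)`; `s` is the new state and `a` the preceding joint action. -/
  O : State → (∀ i, Act i) → stdSimplex ℝ (∀ i, Obs i)
  /-- Initial state distribution. -/
  b0 : stdSimplex ℝ State
  T : ℕ

attribute [instance] DecPOMDP.stateFintype DecPOMDP.actFintype DecPOMDP.actNonempty
  DecPOMDP.obsFintype

/-- Relabeling of a probability mass function along a bijection, `y ↦ p (e⁻¹ y)`. -/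
def simplexCongr {X : Type*} {Y : Type*} [Fintype X] [Fintype Y] (e : X ≃ Y)
    (p : stdSimplex ℝ X) : stdSimplex ℝ Y :=
  ⟨fun y => p (e.symm y), fun y => p.2.1 (e.symm y),
    (Equiv.sum_comp e.symm (fun x => p x)).trans p.2.2⟩

namespace DecPOMDP

/-! ### Policies -/

/-- Local stochastic policies of agent `i`: for every `t ∈ {0, …, T}` and every local
action-observation history `τ ∈ (Aᵢ × Oᵢ)ᵗ`, a distribution over actions `πᵢ(· ∣ τ)`. -/
abbrev LocalPolicy (D : DecPOMDP.{u}) (i : Fin D.N) : Type u :=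
  (t : Fin (D.T + 1)) → (Fin (t : ℕ) → D.Act i × D.Obs i) → stdSimplex ℝ (D.Act i)

/-- Joint policies. The (automatically inferred) `σ`-algebra is the product one, which is the Borel
`σ`-algebra of the policies as a subset of a finite-dimensional real vector space. -/
abbrev Policy (D : DecPOMDP.{u}) : Type u := (i : Fin D.N) → D.LocalPolicy i

/-! ### Histories, the process under a policy, and the expected return -/

/-- Histories of length `t`: states `s₀, …, sₜ`, joint actions `a₀, …, aₜ` and joint observations
`o₁, …, oₜ` (the entry of index `k` is `oₖ₊₁`). Rewards are functions of these. -/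
abbrev Hist (D : DecPOMDP.{u}) (t : ℕ) : Type u :=
  (Fin (t + 1) → D.State) × (Fin (t + 1) → ∀ i, D.Act i) × (Fin t → ∀ i, D.Obs i)

/-- The local action-observation history `(aᵢ₀, oᵢ₁, …, aᵢ₍ₖ₋₁₎, oᵢₖ)` of agent `i` at step `k`. -/
def aoHist {D : DecPOMDP.{u}} {t : ℕ} (h : D.Hist t) (i : Fin D.N) (k : ℕ) (hk : k ≤ t) :
    Fin k → D.Act i × D.Obs i :=
  fun l => (h.2.1 ⟨l, by omega⟩ i, h.2.2 ⟨l, by omega⟩ i)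

/-- `ℙ_π(Hₜ = h)`: `S₀ ∼ b₀`, `Sₖ₊₁ ∼ P(· ∣ Sₖ, Aₖ)`, `Oₖ₊₁ ∼ O(· ∣ Sₖ₊₁, Aₖ)`, and at every step
each agent samples its action independently from its local policy. -/
noncomputable def histProb {D : DecPOMDP.{u}} (π : D.Policy) (t : ℕ) (ht : t ≤ D.T)
    (h : D.Hist t) : ℝ :=
  D.b0 (h.1 0) *
    (∏ k : Fin t, D.P (h.1 k.castSucc) (h.2.1 k.castSucc) (h.1 k.succ) *
      D.O (h.1 k.succ) (h.2.1 k.castSucc) (h.2.2 k)) *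
    ∏ k : Fin (t + 1), ∏ i : Fin D.N,
      π i ⟨k, by omega⟩ (aoHist h i k (by omega)) (h.2.1 k i)

/-- The self-play objective `J(π) = 𝔼_π[∑ₜ Rₜ]`. -/
noncomputable def J (D : DecPOMDP.{u}) (π : D.Policy) : ℝ :=
  ∑ h : D.Hist D.T, histProb π D.T le_rfl h * ∑ t : Fin (D.T + 1), D.R (h.1 t) (h.2.1 t)

/-! ### Isomorphisms and pushforward policies -/

/-- Isomorphisms from `D` to `E`. The component maps are indexed by the agents `j` of the target:
`act j` is the map `f_{A_i} : A_i^D → A_j^E` with `i = f_N⁻¹ j`, and similarly for `obs j`. The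
induced map on joint actions is `f_A(a) = (f_{A_{f_N⁻¹ j}} a_{f_N⁻¹ j})_j`. -/
@[ext]
structure Iso (D : DecPOMDP.{u}) (E : DecPOMDP.{v}) where
  agent : Fin D.N ≃ Fin E.N
  state : D.State ≃ E.State
  act : ∀ j, D.Act (agent.symm j) ≃ E.Act j
  obs : ∀ j, D.Obs (agent.symm j) ≃ E.Obs j
  horizon_eq : D.T = E.T
  map_P : ∀ s s' a, D.P s a s' = E.P (state s) (agent.piCongr' act a) (state s')
  map_O : ∀ s a o, D.O s a o = E.O (state s) (agent.piCongr' act a) (agent.piCongr' obs o)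
  map_R : ∀ s a, D.R s a = E.R (state s) (agent.piCongr' act a)
  map_b0 : ∀ s, D.b0 s = E.b0 (state s)

/-- Automorphisms of `D`. -/
abbrev Aut (D : DecPOMDP.{u}) : Type u := Iso D D

instance (D : DecPOMDP.{u}) (E : DecPOMDP.{v}) : Finite (Iso D E) := by
  let F : Iso D E → (Σ e : Fin D.N ≃ Fin E.N, (D.State ≃ E.State) ×
      (∀ j, D.Act (e.symm j) ≃ E.Act j) × (∀ j, D.Obs (e.symm j) ≃ E.Obs j)) :=
    fun f => ⟨f.agent, f.state, f.act, f.obs⟩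
  refine Finite.of_injective F ?_
  rintro ⟨a, s, c, o, _, _, _, _, _⟩ ⟨a', s', c', o', _, _, _, _, _⟩ h
  simp only [F, Sigma.mk.injEq] at h
  obtain ⟨rfl, h⟩ := h
  simp only [heq_eq_eq, Prod.mk.injEq] at h
  obtain ⟨rfl, rfl, rfl⟩ := h
  rfl

noncomputable instance (D : DecPOMDP.{u}) (E : DecPOMDP.{v}) : Fintype (Iso D E) :=
  Fintype.ofFinite _

instance (D : DecPOMDP.{u}) : Nonempty D.Aut :=
  ⟨{ agent := Equiv.refl _, state := Equiv.refl _, act := fun _ => Equiv.refl _,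
     obs := fun _ => Equiv.refl _, horizon_eq := rfl, map_P := fun _ _ _ => rfl,
     map_O := fun _ _ _ => rfl, map_R := fun _ _ => rfl, map_b0 := fun _ => rfl }⟩

/-- Pushforward policy, `(f^*π)ⱼ(a ∣ τ) = π_{f⁻¹j}(f⁻¹a ∣ f⁻¹τ)`. -/
def push {D : DecPOMDP.{u}} {E : DecPOMDP.{v}} (f : Iso D E) (π : D.Policy) : E.Policy :=
  fun j t τ => simplexCongr (f.act j)
    (π (f.agent.symm j) (Fin.cast (congrArg (· + 1) f.horizon_eq.symm) t)
      (fun l => ((f.act j).symm (τ l).1, (f.obs j).symm (τ l).2)))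

theorem measurable_push {D : DecPOMDP.{u}} {E : DecPOMDP.{v}} (f : Iso D E) :
    Measurable (push f) := by
  refine measurable_pi_lambda _ fun j => measurable_pi_lambda _ fun t =>
    measurable_pi_lambda _ fun τ => Measurable.subtype_mk (measurable_pi_lambda _ fun a => ?_)
  exact (measurable_pi_apply _).comp (measurable_subtype_coe.comp ((measurable_pi_apply _).comp
    ((measurable_pi_apply _).comp (measurable_pi_apply _))))

/-- Pushforward `f^*ν = ν ∘ (f^*)⁻¹` of a distribution over joint policies. -/
noncomputable def pushDist {D : DecPOMDP.{u}} {E : DecPOMDP.{v}} (f : Iso D E)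
    (ν : ProbabilityMeasure D.Policy) : ProbabilityMeasure E.Policy :=
  ν.map (measurable_push f).aemeasurable

/-! ### Other-play -/

/-- For a profile `g` of automorphisms, the joint policy `g^*π` with `(g^*π)ᵢ = (gᵢ^*π)ᵢ`. -/
def profilePush {D : DecPOMDP.{u}} (g : Fin D.N → D.Aut) (π : D.Policy) : D.Policy :=
  fun i => push (g i) π i

/-- The other-play objective, the average of `J(g^*π)` over all profiles `g` of automorphisms. -/
noncomputable def JOP (D : DecPOMDP.{u}) (π : D.Policy) : ℝ :=
  Finset.expect Finset.univ fun g : Fin D.N → D.Aut => D.J (profilePush g π)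

/-- The set of OP-optimal policies. -/
def opOptimal (D : DecPOMDP.{u}) : Set D.Policy := {π | ∀ π', D.JOP π' ≤ D.JOP π}

/-- The OP distribution `|Aut(D)|^{-N} ∑_g δ_{g^*π}` of `π`. -/
noncomputable def opDist {D : DecPOMDP.{u}} (π : D.Policy) : ProbabilityMeasure D.Policy :=
  ⟨((Fintype.card (Fin D.N → D.Aut) : ℝ≥0∞)⁻¹) •
      ∑ g : Fin D.N → D.Aut, Measure.dirac (profilePush g π), ⟨by
    simp only [Measure.smul_apply, Measure.coe_finsetSum, Finset.sum_apply, measure_univ,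
      Finset.sum_const, Finset.card_univ, nsmul_eq_mul, mul_one, smul_eq_mul]
    exact ENNReal.inv_mul_cancel (Nat.cast_ne_zero.2 Fintype.card_ne_zero)
      (ENNReal.natCast_ne_top _)⟩⟩

/-! ### Policies corresponding to distributions over policies, and the symmetrizer -/

open scoped Classical in
/-- `ℙ_π(AO_{i,t} = τ)`. -/
noncomputable def aoProb {D : DecPOMDP.{u}} (π : D.Policy) (i : Fin D.N) (t : Fin (D.T + 1))
    (τ : Fin (t : ℕ) → D.Act i × D.Obs i) : ℝ :=
  ∑ h : D.Hist t, if aoHist h i t le_rfl = τ then histProb π t (by omega) h else 0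

open scoped Classical in
/-- `ℙ_π(AO_{i,t} = τ, A_{i,t} = a)`. -/
noncomputable def aoActProb {D : DecPOMDP.{u}} (π : D.Policy) (i : Fin D.N) (t : Fin (D.T + 1))
    (τ : Fin (t : ℕ) → D.Act i × D.Obs i) (a : D.Act i) : ℝ :=
  ∑ h : D.Hist t, if aoHist h i t le_rfl = τ ∧ h.2.1 (Fin.last t) i = a then
    histProb π t (by omega) h else 0

/-- `ℙ_μ(AO_{i,t} = τ)` for `μ = ⊗ⱼ μⱼ`: first a joint policy is drawn from `μ`, then it is
followed. -/
noncomputable def mixAOProb {D : DecPOMDP.{u}} (μ : ∀ j, ProbabilityMeasure (D.LocalPolicy j))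
    (i : Fin D.N) (t : Fin (D.T + 1)) (τ : Fin (t : ℕ) → D.Act i × D.Obs i) : ℝ :=
  ∫ π, aoProb π i t τ ∂(Measure.pi fun j => (μ j : Measure (D.LocalPolicy j)))

/-- `ℙ_μ(AO_{i,t} = τ, A_{i,t} = a)` for `μ = ⊗ⱼ μⱼ`. -/
noncomputable def mixAOActProb {D : DecPOMDP.{u}} (μ : ∀ j, ProbabilityMeasure (D.LocalPolicy j))
    (i : Fin D.N) (t : Fin (D.T + 1)) (τ : Fin (t : ℕ) → D.Act i × D.Obs i) (a : D.Act i) : ℝ :=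
  ∫ π, aoActProb π i t τ a ∂(Measure.pi fun j => (μ j : Measure (D.LocalPolicy j)))

theorem histProb_nonneg {D : DecPOMDP.{u}} (π : D.Policy) (t : ℕ) (ht : t ≤ D.T) (h : D.Hist t) :
    0 ≤ histProb π t ht h :=
  mul_nonneg (mul_nonneg (stdSimplex.zero_le _ _) (Finset.prod_nonneg fun _ _ =>
    mul_nonneg (stdSimplex.zero_le _ _) (stdSimplex.zero_le _ _)))
    (Finset.prod_nonneg fun _ _ => Finset.prod_nonneg fun _ _ => stdSimplex.zero_le _ _)

theorem histProb_le_one {D : DecPOMDP.{u}} (π : D.Policy) (t : ℕ) (ht : t ≤ D.T) (h : D.Hist t) :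
    histProb π t ht h ≤ 1 := by
  refine mul_le_one₀ (mul_le_one₀ (stdSimplex.le_one _ _) (Finset.prod_nonneg fun _ _ =>
    mul_nonneg (stdSimplex.zero_le _ _) (stdSimplex.zero_le _ _)) ?_)
    (Finset.prod_nonneg fun _ _ => Finset.prod_nonneg fun _ _ => stdSimplex.zero_le _ _) ?_
  · exact Finset.prod_le_one
      (fun _ _ => mul_nonneg (stdSimplex.zero_le _ _) (stdSimplex.zero_le _ _))
      (fun _ _ => mul_le_one₀ (stdSimplex.le_one _ _) (stdSimplex.zero_le _ _)
        (stdSimplex.le_one _ _))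
  · exact Finset.prod_le_one
      (fun _ _ => Finset.prod_nonneg fun _ _ => stdSimplex.zero_le _ _)
      (fun _ _ => Finset.prod_le_one (fun _ _ => stdSimplex.zero_le _ _)
        (fun _ _ => stdSimplex.le_one _ _))

theorem measurable_histProb {D : DecPOMDP.{u}} (t : ℕ) (ht : t ≤ D.T) (h : D.Hist t) :
    Measurable fun π : D.Policy => histProb π t ht h := by
  refine Measurable.const_mul (Finset.measurable_fun_prod _ fun k _ =>
    Finset.measurable_fun_prod _ fun i _ => ?_) _
  exact (measurable_pi_apply _).comp (measurable_subtype_coe.comp ((measurable_pi_apply _).comp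
    ((measurable_pi_apply _).comp (measurable_pi_apply _))))

theorem integrable_histProb {D : DecPOMDP.{u}} (m : Measure D.Policy) [IsFiniteMeasure m]
    (t : ℕ) (ht : t ≤ D.T) (h : D.Hist t) :
    Integrable (fun π : D.Policy => histProb π t ht h) m :=
  Integrable.of_bound (measurable_histProb t ht h).aestronglyMeasurable 1
    (Filter.Eventually.of_forall fun π => by
      rw [Real.norm_of_nonneg (histProb_nonneg π t ht h)]
      exact histProb_le_one π t ht h)

theorem integrable_aoActProb {D : DecPOMDP.{u}} (m : Measure D.Policy) [IsFiniteMeasure m]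
    (i : Fin D.N) (t : Fin (D.T + 1)) (τ : Fin (t : ℕ) → D.Act i × D.Obs i) (a : D.Act i) :
    Integrable (fun π : D.Policy => aoActProb π i t τ a) m := by
  unfold aoActProb
  refine integrable_finsetSum _ fun h _ => ?_
  split_ifs
  · exact integrable_histProb m _ _ h
  · exact integrable_zero _ _ _

theorem aoActProb_nonneg {D : DecPOMDP.{u}} (π : D.Policy) (i : Fin D.N) (t : Fin (D.T + 1))
    (τ : Fin (t : ℕ) → D.Act i × D.Obs i) (a : D.Act i) : 0 ≤ aoActProb π i t τ a := by
  unfold aoActProb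
  refine Finset.sum_nonneg fun h _ => ?_
  split_ifs
  · exact histProb_nonneg _ _ _ _
  · exact le_rfl

theorem sum_aoActProb {D : DecPOMDP.{u}} (π : D.Policy) (i : Fin D.N) (t : Fin (D.T + 1))
    (τ : Fin (t : ℕ) → D.Act i × D.Obs i) : ∑ a, aoActProb π i t τ a = aoProb π i t τ := by
  classical
  unfold aoActProb aoProb
  rw [Finset.sum_comm]
  refine Finset.sum_congr rfl fun h _ => ?_
  by_cases hτ : aoHist h i t le_rfl = τ <;> simp [hτ]

theorem sum_mixAOActProb {D : DecPOMDP.{u}} (μ : ∀ j, ProbabilityMeasure (D.LocalPolicy j))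
    (i : Fin D.N) (t : Fin (D.T + 1)) (τ : Fin (t : ℕ) → D.Act i × D.Obs i) :
    ∑ a, mixAOActProb μ i t τ a = mixAOProb μ i t τ := by
  unfold mixAOActProb mixAOProb
  rw [← integral_finsetSum _ fun a _ => integrable_aoActProb _ i t τ a]
  simp only [sum_aoActProb]

open scoped Classical in
/-- The local policy corresponding to a distribution `ν` over local policies of agent `i`:
`a ↦ ℙ_μ(A_{i,t} = a ∣ AO_{i,t} = τ)`, where `μ = ⊗ⱼ μⱼ` is any distribution with independent local
policies and `μᵢ = ν` for which the conditioning event has positive probability; it is the uniform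
distribution if there is no such `μ`. -/
noncomputable def localMixture {D : DecPOMDP.{u}} (i : Fin D.N)
    (ν : ProbabilityMeasure (D.LocalPolicy i)) : D.LocalPolicy i := fun t τ =>
  if hμ : ∃ μ : ∀ j, ProbabilityMeasure (D.LocalPolicy j), μ i = ν ∧ 0 < mixAOProb μ i t τ then
    ⟨fun a => mixAOActProb hμ.choose i t τ a / mixAOProb hμ.choose i t τ,
      fun a => div_nonneg (integral_nonneg fun π => aoActProb_nonneg π i t τ a)
        hμ.choose_spec.2.le,
      by rw [← Finset.sum_div, sum_mixAOActProb, div_self hμ.choose_spec.2.ne']⟩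
  else stdSimplex.barycenter

/-- The symmetrizer `Ψ`: the joint policy corresponding to the OP distribution of `π`. -/
noncomputable def symmetrizer {D : DecPOMDP.{u}} (π : D.Policy) : D.Policy :=
  fun i => localMixture i ((opDist π).map (measurable_pi_apply i).aemeasurable)

/-- The equivalence class `[π]` of `π`, where `π' ≡ π` means `Ψ(π') = Ψ(π)`. -/
def eqvClass {D : DecPOMDP.{u}} (π : D.Policy) : Set D.Policy :=
  {π' | symmetrizer π' = symmetrizer π}

/-! ### Labelings and relabeled Dec-POMDPs -/

/-- Labelings of `D` (the labels `{1, …, k}` are represented by `Fin k`). -/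
structure Labeling (D : DecPOMDP.{u}) where
  agent : Fin D.N ≃ Fin D.N
  state : D.State ≃ Fin (Fintype.card D.State)
  act : ∀ i, D.Act i ≃ Fin (Fintype.card (D.Act i))
  obs : ∀ i, D.Obs i ≃ Fin (Fintype.card (D.Obs i))

instance (D : DecPOMDP.{u}) : Finite D.Labeling := by
  refine Finite.of_injective (fun f : D.Labeling => (f.agent, f.state, f.act, f.obs)) ?_
  rintro ⟨a, s, c, o⟩ ⟨a', s', c', o'⟩ h
  simp only [Prod.mk.injEq] at h
  obtain ⟨rfl, rfl, rfl, rfl⟩ := h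
  rfl

namespace Labeling

/-- The action of a labeling on joint actions, `f a = (f_{A_{f⁻¹i}} a_{f⁻¹i})ᵢ`. -/
def jointAct {D : DecPOMDP.{u}} (f : D.Labeling) :
    (∀ i, D.Act i) ≃ ∀ i, Fin (Fintype.card (D.Act (f.agent.symm i))) :=
  f.agent.piCongr' fun i => f.act (f.agent.symm i)

/-- The action of a labeling on joint observations. -/
def jointObs {D : DecPOMDP.{u}} (f : D.Labeling) :
    (∀ i, D.Obs i) ≃ ∀ i, Fin (Fintype.card (D.Obs (f.agent.symm i))) :=
  f.agent.piCongr' fun i => f.obs (f.agent.symm i)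

end Labeling

/-- The relabeled Dec-POMDP `f^*D`. -/
def relabel (D : DecPOMDP.{u}) (f : D.Labeling) : DecPOMDP.{0} where
  N := D.N
  State := Fin (Fintype.card D.State)
  Act := fun i => Fin (Fintype.card (D.Act (f.agent.symm i)))
  actNonempty := fun i => Nonempty.map (f.act (f.agent.symm i)) inferInstance
  Obs := fun i => Fin (Fintype.card (D.Obs (f.agent.symm i)))
  P := fun s a => simplexCongr f.state (D.P (f.state.symm s) (f.jointAct.symm a))
  R := fun s a => D.R (f.state.symm s) (f.jointAct.symm a)
  O := fun s a => simplexCongr f.jointObs (D.O (f.state.symm s) (f.jointAct.symm a))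
  b0 := simplexCongr f.state D.b0
  T := D.T

/-- The set of all relabeled versions of `D`. -/
def relabelings (D : DecPOMDP.{u}) : Set DecPOMDP.{0} := Set.range D.relabel

noncomputable instance (D : DecPOMDP.{u}) : Fintype D.relabelings :=
  (Set.finite_range D.relabel).fintype

/-! ### Learning algorithms and the label-free coordination game -/

/-- Learning algorithms for a set `C` of Dec-POMDPs. -/
abbrev LearningAlg (C : Set DecPOMDP.{u}) : Type (u + 1) :=
  (E : C) → ProbabilityMeasure E.1.Policy

/-- The common payoff `U^D(σ₁, …, σ_N)` of the LFC game for `D`: each principal `k` independently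
gets a uniformly random relabeled problem `Dₖ` and a uniformly random isomorphism `fₖ` from `Dₖ` to
`D`; joint policies `π⁽ᵏ⁾ ∼ fₖ^* σₖ(Dₖ)` are drawn independently, and `(π⁽ˡ⁾ₗ)ₗ` is evaluated
in `D`. -/
noncomputable def payoff (D : DecPOMDP.{u}) (σ : Fin D.N → LearningAlg D.relabelings) : ℝ :=
  Finset.expect Finset.univ fun Ds : Fin D.N → D.relabelings =>
    Finset.expect Finset.univ fun f : ((j : Fin D.N) → Iso (Ds j).1 D) =>
      ∫ π : Fin D.N → D.Policy, D.J (fun l => π l l)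
        ∂(Measure.pi fun k => (pushDist (f k) (σ k (Ds k)) : Measure D.Policy))

/-- The value of a learning algorithm in the LFC problem for `D`: all principals use it. -/
noncomputable def lfcValue (D : DecPOMDP.{u}) (σ : LearningAlg D.relabelings) : ℝ :=
  D.payoff fun _ => σ

/-- A learning algorithm is optimal in the LFC problem for `D`. -/
def IsLFCOptimal (D : DecPOMDP.{u}) (σ : LearningAlg D.relabelings) : Prop :=
  ∀ σ' : LearningAlg D.relabelings, D.lfcValue σ' ≤ D.lfcValue σ

/-- Symmetric strategy profiles: `σᵢ = σ_{g⁻¹i}` for all automorphisms `g` and principals `i`. -/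
def IsSymmetricProfile (D : DecPOMDP.{u}) (σ : Fin D.N → LearningAlg D.relabelings) : Prop :=
  ∀ (g : D.Aut) (i : Fin D.N), σ i = σ (g.agent.symm i)

/-- Optimal symmetric strategy profiles of the LFC game for `D`. -/
def IsOptimalSymmetricProfile (D : DecPOMDP.{u}) (σ : Fin D.N → LearningAlg D.relabelings) :
    Prop :=
  D.IsSymmetricProfile σ ∧ ∀ σ', D.IsSymmetricProfile σ' → D.payoff σ' ≤ D.payoff σ

/-! ### Other-play with tie-breaking -/

/-- `χ` is a tie-breaking function for `C`: it attains a maximum on the OP-optimal policies of every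
`E ∈ C`, and policies of `E` with equal values are equivalent. -/
def IsTieBreaking (C : Set DecPOMDP.{u}) (χ : (E : C) → E.1.Policy → Set.Icc (0 : ℝ) 1) : Prop :=
  (∀ E : C, ∃ π ∈ E.1.opOptimal, IsMaxOn (χ E) E.1.opOptimal π) ∧
  ∀ (E : C) (π π' : E.1.Policy), χ E π = χ E π' → symmetrizer π = symmetrizer π'

/-- `χ` is invariant to isomorphism: `f^*[π] = [π']` implies `χ(E, π) = χ(F, π')`, where
`f^*[π] = [f^*π]`. -/
def IsIsoInvariant (C : Set DecPOMDP.{u}) (χ : (E : C) → E.1.Policy → Set.Icc (0 : ℝ) 1) : Prop :=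
  ∀ (E F : C) (f : Iso E.1 F.1) (π : E.1.Policy) (π' : F.1.Policy),
    eqvClass (push f π) = eqvClass π' → χ E π = χ F π'

/-- `σ` is an OP with tie-breaking learning algorithm for `C` and `χ`: on every `E ∈ C` it is
concentrated on a measurable set of OP-optimal policies that maximize `χ` among these. -/
def IsOPWithTieBreaking (C : Set DecPOMDP.{u}) (χ : (E : C) → E.1.Policy → Set.Icc (0 : ℝ) 1)
    (σ : LearningAlg C) : Prop :=
  ∀ E : C, ∃ Z : Set E.1.Policy, MeasurableSet Z ∧ Z ⊆ E.1.opOptimal ∧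
    (σ E : Measure E.1.Policy) Z = 1 ∧ ∀ π ∈ Z, IsMaxOn (χ E) E.1.opOptimal π

end DecPOMDP

/-! The probability of a history is an environment factor times, for each agent, the probability
that its local policy plays its own actions along its local history. The return is therefore
multilinear in these realization weights (`J_eq_planValue`), and independent mixtures of local
policies matter only through their mean weights. As in Kuhn's theorem, a single policy with the
right conditional action probabilities has these mean weights (`J_of_conditions`). This serves both
for the symmetrizer, built from `localMixture`, and for the policy `behavioral` that replaces a
strategy profile.

Upper bound: the uniformly random isomorphism makes the law of each principal's transported joint
policy invariant under automorphisms. In a symmetric profile the resulting behavioral policy is then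
fixed by every automorphism, so its return equals its other-play value, and the payoff is at most
the maximum of `JOP` (`payoff_eq_JOP_behavioral`).

Attainment: composing the random isomorphisms with independent automorphisms changes nothing, so the
payoff is an average of `crossOP`, the other-play return of agents that may take their parts from
different joint policies (`payoff_eq_crossOP`). Such a return sees only the symmetrizers of these
policies (`crossOP_eq_J_symmetrizer`). Invariance of the tie-breaking function forces its maximizers
in isomorphic problems to have the same symmetrizer after transport (`symmetrizer_push_eq`).
Independent principals thus coordinate almost surely, and the payoff is the optimal other-play
value. -/

namespace DecPOMDP

/-! ### Realization weights -/

/-- The part of the probability of a history that is due to the environment. -/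
noncomputable def envWeight {D : DecPOMDP.{u}} {t : ℕ} (h : D.Hist t) : ℝ :=
  D.b0 (h.1 0) *
    ∏ k : Fin t, D.P (h.1 k.castSucc) (h.2.1 k.castSucc) (h.1 k.succ) *
      D.O (h.1 k.succ) (h.2.1 k.castSucc) (h.2.2 k)

/-- The probability with which the local policy `p` plays the actions of the local history `τ`. -/
noncomputable def playProb {D : DecPOMDP.{u}} {i : Fin D.N} (p : D.LocalPolicy i) (t : ℕ)
    (ht : t ≤ D.T + 1) (τ : Fin t → D.Act i × D.Obs i) : ℝ :=
  ∏ k : Fin t, p ⟨k, by omega⟩ (fun l : Fin (k : ℕ) => τ ⟨l, by omega⟩) (τ k).1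

/-- The probability with which `p` plays the actions of `τ` and then `a`. -/
noncomputable def playActProb {D : DecPOMDP.{u}} {i : Fin D.N} (p : D.LocalPolicy i)
    (t : Fin (D.T + 1)) (τ : Fin (t : ℕ) → D.Act i × D.Obs i) (a : D.Act i) : ℝ :=
  playProb p t t.2.le τ * p t τ a

theorem playProb_zero {D : DecPOMDP.{u}} {i : Fin D.N} (p : D.LocalPolicy i)
    (ht : 0 ≤ D.T + 1) (τ : Fin 0 → D.Act i × D.Obs i) : playProb p 0 ht τ = 1 := by
  simp [playProb]

theorem playProb_succ {D : DecPOMDP.{u}} {i : Fin D.N} (p : D.LocalPolicy i) (t : ℕ)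
    (ht : t + 1 ≤ D.T + 1) (τ : Fin (t + 1) → D.Act i × D.Obs i) :
    playProb p (t + 1) ht τ =
      playActProb p ⟨t, ht⟩ (fun l => τ l.castSucc) (τ (Fin.last t)).1 := by
  rw [playProb, Fin.prod_univ_castSucc]
  rfl

theorem playProb_nonneg {D : DecPOMDP.{u}} {i : Fin D.N} (p : D.LocalPolicy i) (t : ℕ)
    (ht : t ≤ D.T + 1) (τ : Fin t → D.Act i × D.Obs i) : 0 ≤ playProb p t ht τ :=
  Finset.prod_nonneg fun _ _ => stdSimplex.zero_le _ _

theorem playProb_le_one {D : DecPOMDP.{u}} {i : Fin D.N} (p : D.LocalPolicy i) (t : ℕ)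
    (ht : t ≤ D.T + 1) (τ : Fin t → D.Act i × D.Obs i) : playProb p t ht τ ≤ 1 :=
  Finset.prod_le_one (fun _ _ => stdSimplex.zero_le _ _) fun _ _ => stdSimplex.le_one _ _

theorem playActProb_nonneg {D : DecPOMDP.{u}} {i : Fin D.N} (p : D.LocalPolicy i)
    (t : Fin (D.T + 1)) (τ : Fin (t : ℕ) → D.Act i × D.Obs i) (a : D.Act i) :
    0 ≤ playActProb p t τ a :=
  mul_nonneg (playProb_nonneg _ _ _ _) (stdSimplex.zero_le _ _)

theorem playActProb_le {D : DecPOMDP.{u}} {i : Fin D.N} (p : D.LocalPolicy i)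
    (t : Fin (D.T + 1)) (τ : Fin (t : ℕ) → D.Act i × D.Obs i) (a : D.Act i) :
    playActProb p t τ a ≤ playProb p t t.2.le τ :=
  mul_le_of_le_one_right (playProb_nonneg _ _ _ _) (stdSimplex.le_one _ _)

theorem playActProb_le_one {D : DecPOMDP.{u}} {i : Fin D.N} (p : D.LocalPolicy i)
    (t : Fin (D.T + 1)) (τ : Fin (t : ℕ) → D.Act i × D.Obs i) (a : D.Act i) :
    playActProb p t τ a ≤ 1 :=
  (playActProb_le p t τ a).trans (playProb_le_one _ _ _ _)

theorem sum_playActProb {D : DecPOMDP.{u}} {i : Fin D.N} (p : D.LocalPolicy i)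
    (t : Fin (D.T + 1)) (τ : Fin (t : ℕ) → D.Act i × D.Obs i) :
    ∑ a, playActProb p t τ a = playProb p t t.2.le τ := by
  simp only [playActProb, ← Finset.mul_sum]
  rw [show ∑ a, p t τ a = 1 from (p t τ).2.2, mul_one]

theorem measurable_localPolicy_apply {D : DecPOMDP.{u}} {i : Fin D.N} (t : Fin (D.T + 1))
    (τ : Fin (t : ℕ) → D.Act i × D.Obs i) (a : D.Act i) :
    Measurable fun p : D.LocalPolicy i => p t τ a :=
  (measurable_pi_apply _).comp (measurable_subtype_coe.comp ((measurable_pi_apply _).comp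
    (measurable_pi_apply _)))

theorem measurable_playProb {D : DecPOMDP.{u}} {i : Fin D.N} (t : ℕ)
    (ht : t ≤ D.T + 1) (τ : Fin t → D.Act i × D.Obs i) :
    Measurable fun p : D.LocalPolicy i => playProb p t ht τ :=
  Finset.measurable_fun_prod _ fun _ _ => measurable_localPolicy_apply _ _ _

theorem measurable_playActProb {D : DecPOMDP.{u}} {i : Fin D.N} (t : Fin (D.T + 1))
    (τ : Fin (t : ℕ) → D.Act i × D.Obs i) (a : D.Act i) :
    Measurable fun p : D.LocalPolicy i => playActProb p t τ a :=
  (measurable_playProb _ _ _).mul (measurable_localPolicy_apply _ _ _)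

theorem integrable_playActProb {D : DecPOMDP.{u}} {i : Fin D.N} (m : Measure (D.LocalPolicy i))
    [IsFiniteMeasure m] (t : Fin (D.T + 1))
    (τ : Fin (t : ℕ) → D.Act i × D.Obs i) (a : D.Act i) :
    Integrable (fun p : D.LocalPolicy i => playActProb p t τ a) m :=
  Integrable.of_bound (measurable_playActProb t τ a).aestronglyMeasurable 1
    (Filter.Eventually.of_forall fun p => by
      rw [Real.norm_of_nonneg (playActProb_nonneg p t τ a)]
      exact playActProb_le_one p t τ a)

theorem integrable_playProb {D : DecPOMDP.{u}} {i : Fin D.N} (m : Measure (D.LocalPolicy i))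
    [IsFiniteMeasure m] (t : ℕ) (ht : t ≤ D.T + 1) (τ : Fin t → D.Act i × D.Obs i) :
    Integrable (fun p : D.LocalPolicy i => playProb p t ht τ) m :=
  Integrable.of_bound (measurable_playProb t ht τ).aestronglyMeasurable 1
    (Filter.Eventually.of_forall fun p => by
      rw [Real.norm_of_nonneg (playProb_nonneg p t ht τ)]
      exact playProb_le_one p t ht τ)

theorem envWeight_nonneg {D : DecPOMDP.{u}} {t : ℕ} (h : D.Hist t) : 0 ≤ envWeight h :=
  mul_nonneg (stdSimplex.zero_le _ _) (Finset.prod_nonneg fun _ _ =>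
    mul_nonneg (stdSimplex.zero_le _ _) (stdSimplex.zero_le _ _))

/-- Actions are drawn independently given the local histories, so the product over steps and agents
can be regrouped agent by agent. -/
theorem histProb_eq_envWeight_mul {D : DecPOMDP.{u}} (π : D.Policy) (t : ℕ) (ht : t ≤ D.T)
    (h : D.Hist t) :
    histProb π t ht h = envWeight h *
      ∏ i, playActProb (π i) ⟨t, Nat.lt_succ_of_le ht⟩ (aoHist h i t le_rfl)
        (h.2.1 (Fin.last t) i) := by
  rw [histProb, Finset.prod_comm]
  refine congrArg₂ _ rfl (Finset.prod_congr rfl fun i _ => ?_)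
  rw [Fin.prod_univ_castSucc]
  rfl

/-- The expected return, expressed through weights `y` for the agents' local plays. -/
noncomputable def planValue (D : DecPOMDP.{u})
    (y : ∀ i, (Fin D.T → D.Act i × D.Obs i) → D.Act i → ℝ) : ℝ :=
  ∑ h : D.Hist D.T, envWeight h *
    (∏ i, y i (aoHist h i D.T le_rfl) (h.2.1 (Fin.last D.T) i)) *
    ∑ t : Fin (D.T + 1), D.R (h.1 t) (h.2.1 t)

/-- Each agent enters through one factor per history, its weight at the final step. This
multilinearity is what lets averages over independent choices pass inside. -/
theorem J_eq_planValue {D : DecPOMDP.{u}} (π : D.Policy) :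
    D.J π = D.planValue fun i => playActProb (π i) (Fin.last D.T) := by
  refine Finset.sum_congr rfl fun h _ => ?_
  rw [histProb_eq_envWeight_mul]
  rfl

/-! ### Mixtures of local policies -/

/-- The mean over `ν` of `playProb`. -/
noncomputable def meanPlayProb {D : DecPOMDP.{u}} {i : Fin D.N}
    (ν : ProbabilityMeasure (D.LocalPolicy i)) (t : ℕ)
    (ht : t ≤ D.T + 1) (τ : Fin t → D.Act i × D.Obs i) : ℝ :=
  ∫ p, playProb p t ht τ ∂(ν : Measure (D.LocalPolicy i))

/-- The mean over `ν` of `playActProb`. -/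
noncomputable def meanPlayActProb {D : DecPOMDP.{u}} {i : Fin D.N}
    (ν : ProbabilityMeasure (D.LocalPolicy i)) (t : Fin (D.T + 1))
    (τ : Fin (t : ℕ) → D.Act i × D.Obs i) (a : D.Act i) : ℝ :=
  ∫ p, playActProb p t τ a ∂(ν : Measure (D.LocalPolicy i))

theorem meanPlayProb_nonneg {D : DecPOMDP.{u}} {i : Fin D.N}
    (ν : ProbabilityMeasure (D.LocalPolicy i)) (t : ℕ)
    (ht : t ≤ D.T + 1) (τ : Fin t → D.Act i × D.Obs i) : 0 ≤ meanPlayProb ν t ht τ :=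
  integral_nonneg fun p => playProb_nonneg p t ht τ

theorem meanPlayActProb_nonneg {D : DecPOMDP.{u}} {i : Fin D.N}
    (ν : ProbabilityMeasure (D.LocalPolicy i)) (t : Fin (D.T + 1))
    (τ : Fin (t : ℕ) → D.Act i × D.Obs i) (a : D.Act i) : 0 ≤ meanPlayActProb ν t τ a :=
  integral_nonneg fun p => playActProb_nonneg p t τ a

theorem sum_meanPlayActProb {D : DecPOMDP.{u}} {i : Fin D.N}
    (ν : ProbabilityMeasure (D.LocalPolicy i)) (t : Fin (D.T + 1))
    (τ : Fin (t : ℕ) → D.Act i × D.Obs i) :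
    ∑ a, meanPlayActProb ν t τ a = meanPlayProb ν t t.2.le τ := by
  unfold meanPlayActProb meanPlayProb
  rw [← integral_finsetSum _ fun a _ => integrable_playActProb _ t τ a]
  simp only [sum_playActProb]

theorem meanPlayActProb_le {D : DecPOMDP.{u}} {i : Fin D.N}
    (ν : ProbabilityMeasure (D.LocalPolicy i)) (t : Fin (D.T + 1))
    (τ : Fin (t : ℕ) → D.Act i × D.Obs i) (a : D.Act i) :
    meanPlayActProb ν t τ a ≤ meanPlayProb ν t t.2.le τ :=
  integral_mono (integrable_playActProb _ _ _ _) (integrable_playProb _ _ _ _)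
    fun p => playActProb_le p t τ a

/-- A local policy `q` that plays, after `τ`, the action `a` with the conditional probability under
the mixture `ν`. -/
def Conditions {D : DecPOMDP.{u}} {i : Fin D.N} (q : D.LocalPolicy i)
    (ν : ProbabilityMeasure (D.LocalPolicy i)) (t : Fin (D.T + 1))
    (τ : Fin (t : ℕ) → D.Act i × D.Obs i) : Prop :=
  meanPlayProb ν t t.2.le τ ≠ 0 →
    ∀ a, q t τ a = meanPlayActProb ν t τ a / meanPlayProb ν t t.2.le τ

theorem playActProb_of_conditions_of_playProb {D : DecPOMDP.{u}} {i : Fin D.N}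
    {q : D.LocalPolicy i} {ν : ProbabilityMeasure (D.LocalPolicy i)} {t : Fin (D.T + 1)}
    {τ : Fin (t : ℕ) → D.Act i × D.Obs i} (hq : Conditions q ν t τ)
    (hτ : playProb q t t.2.le τ = meanPlayProb ν t t.2.le τ) (a : D.Act i) :
    playActProb q t τ a = meanPlayActProb ν t τ a := by
  rw [playActProb, hτ]
  -- At a local history that the mixture never plays, `q` is unconstrained, but both weights vanish.
  by_cases h0 : meanPlayProb ν t t.2.le τ = 0
  · have := meanPlayActProb_le ν t τ a
    rw [h0] at this ⊢
    rw [zero_mul, le_antisymm this (meanPlayActProb_nonneg ν t τ a)]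
  · rw [hq h0 a, mul_div_cancel₀ _ h0]

/-- Kuhn's argument: the conditional probabilities along the history telescope, by induction on its
length. Only the prefixes of `τ` need to satisfy `Conditions`. -/
theorem playProb_of_conditions {D : DecPOMDP.{u}} {i : Fin D.N}
    {q : D.LocalPolicy i} {ν : ProbabilityMeasure (D.LocalPolicy i)} (t : ℕ) (ht : t ≤ D.T + 1)
    (τ : Fin t → D.Act i × D.Obs i)
    (hq : ∀ k : Fin t, Conditions q ν ⟨k, by omega⟩ fun l : Fin (k : ℕ) => τ ⟨l, by omega⟩) :
    playProb q t ht τ = meanPlayProb ν t ht τ := by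
  induction t with
  | zero => simp [meanPlayProb, playProb_zero]
  | succ t ih =>
    simp only [meanPlayProb, playProb_succ]
    refine playActProb_of_conditions_of_playProb (hq (Fin.last t)) ?_ _
    exact ih _ _ fun k => hq k.castSucc

/-- Histories of environment weight zero do not contribute to the return. The restriction to the
others is needed for `localMixture`, which is uniform at local histories the environment cannot
produce, even if the mixture plays their actions. -/
theorem J_of_conditions {D : DecPOMDP.{u}} (q : D.Policy)
    (ν : ∀ i, ProbabilityMeasure (D.LocalPolicy i))
    (hq : ∀ h : D.Hist D.T, envWeight h ≠ 0 → ∀ i (k : Fin (D.T + 1)),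
      Conditions (q i) (ν i) k (aoHist h i k (Nat.le_of_lt_succ k.2))) :
    D.J q = D.planValue fun i => meanPlayActProb (ν i) (Fin.last D.T) := by
  rw [J_eq_planValue]
  refine Finset.sum_congr rfl fun h _ => ?_
  by_cases h0 : envWeight h = 0
  · simp [h0]
  congr 2
  refine Finset.prod_congr rfl fun i _ => ?_
  refine playActProb_of_conditions_of_playProb (hq h h0 i (Fin.last D.T)) ?_ _
  exact playProb_of_conditions _ _ _ fun k => hq h h0 i k.castSucc

open scoped Classical in
/-- The behavioral policy realizing the mixture `ν`. -/
noncomputable def behavioral {D : DecPOMDP.{u}} {i : Fin D.N}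
    (ν : ProbabilityMeasure (D.LocalPolicy i)) : D.LocalPolicy i := fun t τ =>
  if h : meanPlayProb ν t t.2.le τ = 0 then stdSimplex.barycenter else
    ⟨fun a => meanPlayActProb ν t τ a / meanPlayProb ν t t.2.le τ,
      fun a => div_nonneg (meanPlayActProb_nonneg _ _ _ _) (meanPlayProb_nonneg _ _ _ _),
      by rw [← Finset.sum_div, sum_meanPlayActProb, div_self h]⟩

theorem conditions_behavioral {D : DecPOMDP.{u}} {i : Fin D.N}
    (ν : ProbabilityMeasure (D.LocalPolicy i)) (t : Fin (D.T + 1))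
    (τ : Fin (t : ℕ) → D.Act i × D.Obs i) : Conditions (behavioral ν) ν t τ := by
  intro h0 a
  rw [behavioral, dif_neg h0]
  rfl

theorem J_behavioral {D : DecPOMDP.{u}} (ν : ∀ i, ProbabilityMeasure (D.LocalPolicy i)) :
    D.J (fun i => behavioral (ν i)) =
      D.planValue fun i => meanPlayActProb (ν i) (Fin.last D.T) :=
  J_of_conditions _ ν fun _ _ _ _ => conditions_behavioral _ _ _

/-! ### The local policy corresponding to a distribution -/

open scoped Classical in
/-- The total weight that the environment and the other agents give to the event that agent `i`
observes `τ` when it plays the actions of `τ` and then `a`. -/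
noncomputable def othersWeight {D : DecPOMDP.{u}}
    (μ : ∀ j, ProbabilityMeasure (D.LocalPolicy j)) (i : Fin D.N) (t : Fin (D.T + 1))
    (τ : Fin (t : ℕ) → D.Act i × D.Obs i) (a : D.Act i) : ℝ :=
  ∑ h : D.Hist t, if aoHist h i t le_rfl = τ ∧ h.2.1 (Fin.last t) i = a then
    envWeight h * ∏ j ∈ Finset.univ.erase i,
      meanPlayActProb (μ j) t (aoHist h j t le_rfl) (h.2.1 (Fin.last t) j) else 0

theorem integral_histProb {D : DecPOMDP.{u}} (μ : ∀ j, ProbabilityMeasure (D.LocalPolicy j))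
    (t : Fin (D.T + 1)) (h : D.Hist t) :
    ∫ π, histProb π t (Nat.le_of_lt_succ t.2) h
        ∂(Measure.pi fun j => (μ j : Measure (D.LocalPolicy j))) =
      envWeight h * ∏ j, meanPlayActProb (μ j) t (aoHist h j t le_rfl)
        (h.2.1 (Fin.last t) j) := by
  simp only [histProb_eq_envWeight_mul, integral_const_mul]
  congr 1
  exact integral_fintype_prod_eq_prod
    (fun j (p : D.LocalPolicy j) => playActProb p t (aoHist h j t le_rfl) (h.2.1 (Fin.last t) j))

/-- On the event in question the factor of agent `i` is constant and can be pulled out of the sum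
over histories. -/
theorem mixAOActProb_eq {D : DecPOMDP.{u}} (μ : ∀ j, ProbabilityMeasure (D.LocalPolicy j))
    (i : Fin D.N) (t : Fin (D.T + 1)) (τ : Fin (t : ℕ) → D.Act i × D.Obs i) (a : D.Act i) :
    mixAOActProb μ i t τ a = meanPlayActProb (μ i) t τ a * othersWeight μ i t τ a := by
  unfold mixAOActProb aoActProb othersWeight
  rw [integral_finsetSum, Finset.mul_sum]
  · refine Finset.sum_congr rfl fun h _ => ?_
    split_ifs with hh
    · rw [integral_histProb, ← Finset.mul_prod_erase _ _ (Finset.mem_univ i), hh.1, hh.2]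
      ring
    · simp
  · intro h _
    split_ifs
    · exact integrable_histProb _ _ _ h
    · exact integrable_zero _ _ _

/-- The history `h` with the last action of agent `i` replaced by `a`. -/
def replaceLast {D : DecPOMDP.{u}} {t : ℕ} (h : D.Hist t) (i : Fin D.N) (a : D.Act i) :
    D.Hist t :=
  (h.1, Function.update h.2.1 (Fin.last t) (Function.update (h.2.1 (Fin.last t)) i a), h.2.2)

theorem replaceLast_castSucc {D : DecPOMDP.{u}} {t : ℕ} (h : D.Hist t) (i : Fin D.N)
    (a : D.Act i) (k : Fin t) : (replaceLast h i a).2.1 k.castSucc = h.2.1 k.castSucc :=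
  Function.update_of_ne (Fin.castSucc_lt_last k).ne _ _

theorem envWeight_replaceLast {D : DecPOMDP.{u}} {t : ℕ} (h : D.Hist t) (i : Fin D.N)
    (a : D.Act i) : envWeight (replaceLast h i a) = envWeight h := by
  simp only [envWeight, replaceLast_castSucc]
  rfl

theorem aoHist_replaceLast {D : DecPOMDP.{u}} {t : ℕ} (h : D.Hist t) (i : Fin D.N)
    (a : D.Act i) (j : Fin D.N) :
    aoHist (replaceLast h i a) j t le_rfl = aoHist h j t le_rfl := by
  funext l
  exact Prod.ext (congrFun (replaceLast_castSucc h i a l) j) rfl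

/-- The last action of agent `i` is taken after `τ` is complete, and neither the environment nor the
other agents have reacted to it. Replacing it is a weight-preserving bijection of histories. -/
theorem othersWeight_congr {D : DecPOMDP.{u}} (μ : ∀ j, ProbabilityMeasure (D.LocalPolicy j))
    (i : Fin D.N) (t : Fin (D.T + 1)) (τ : Fin (t : ℕ) → D.Act i × D.Obs i) (a b : D.Act i) :
    othersWeight μ i t τ a = othersWeight μ i t τ b := by
  classical
  unfold othersWeight
  rw [← Finset.sum_filter, ← Finset.sum_filter]
  have key : ∀ (c d : D.Act i) (h : D.Hist t), h.2.1 (Fin.last t) i = c →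
      replaceLast (replaceLast h i d) i c = h := by
    intro c d h hc
    refine Prod.ext rfl (Prod.ext ?_ rfl)
    simp only [replaceLast, Function.update_self, Function.update_idem, ← hc,
      Function.update_eq_self]
  refine Finset.sum_bij' (fun h _ => replaceLast h i b) (fun h _ => replaceLast h i a)
    ?_ ?_ ?_ ?_ ?_
  · intro h hh
    simp only [Finset.mem_filter, Finset.mem_univ, true_and, aoHist_replaceLast] at hh ⊢
    exact ⟨hh.1, by simp [replaceLast]⟩
  · intro h hh
    simp only [Finset.mem_filter, Finset.mem_univ, true_and, aoHist_replaceLast] at hh ⊢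
    exact ⟨hh.1, by simp [replaceLast]⟩
  · intro h hh
    exact key a b h (Finset.mem_filter.1 hh).2.2
  · intro h hh
    exact key b a h (Finset.mem_filter.1 hh).2.2
  · intro h _
    rw [envWeight_replaceLast]
    congr 1
    refine Finset.prod_congr rfl fun j hj => ?_
    rw [aoHist_replaceLast]
    congr 1
    simp [replaceLast, Function.update_of_ne (Finset.ne_of_mem_erase hj)]

/-- The same factor `othersWeight` occurs here and in `mixAOActProb_eq`, so it cancels in the
conditional probability. This is why the choice of the other agents' mixtures is irrelevant. -/
theorem mixAOProb_eq {D : DecPOMDP.{u}} (μ : ∀ j, ProbabilityMeasure (D.LocalPolicy j))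
    (i : Fin D.N) (t : Fin (D.T + 1)) (τ : Fin (t : ℕ) → D.Act i × D.Obs i) (a : D.Act i) :
    mixAOProb μ i t τ = meanPlayProb (μ i) t t.2.le τ * othersWeight μ i t τ a := by
  rw [← sum_mixAOActProb, ← sum_meanPlayActProb, Finset.sum_mul]
  exact Finset.sum_congr rfl fun b _ => by rw [mixAOActProb_eq, othersWeight_congr μ i t τ b a]

/-- The history `h` up to step `k`. -/
def truncate {D : DecPOMDP.{u}} {t : ℕ} (h : D.Hist t) (k : ℕ) (hk : k ≤ t) : D.Hist k :=
  (fun l => h.1 ⟨l, by omega⟩, fun l => h.2.1 ⟨l, by omega⟩, fun l => h.2.2 ⟨l, by omega⟩)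

theorem envWeight_truncate_ne_zero {D : DecPOMDP.{u}} {t : ℕ} (h : D.Hist t)
    (h0 : envWeight h ≠ 0) (k : ℕ) (hk : k ≤ t) : envWeight (truncate h k hk) ≠ 0 := by
  obtain ⟨hb, hp⟩ := mul_ne_zero_iff.1 h0
  refine mul_ne_zero hb (Finset.prod_ne_zero_iff.2 fun l _ => ?_)
  -- The environment factors of a prefix are among those of the whole history.
  exact Finset.prod_ne_zero_iff.1 hp (Fin.castLE hk l) (Finset.mem_univ _)

/-- The local policy that always plays uniformly. -/
noncomputable def uniformPolicy {D : DecPOMDP.{u}} (i : Fin D.N) : D.LocalPolicy i :=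
  fun _ _ => stdSimplex.barycenter

theorem playActProb_uniformPolicy_pos {D : DecPOMDP.{u}} {i : Fin D.N} (t : Fin (D.T + 1))
    (τ : Fin (t : ℕ) → D.Act i × D.Obs i) (a : D.Act i) :
    0 < playActProb (uniformPolicy i) t τ a := by
  have hpos : ∀ b : D.Act i, 0 < (stdSimplex.barycenter : stdSimplex ℝ (D.Act i)) b := by
    intro b
    change 0 < (Fintype.card (D.Act i) : ℝ)⁻¹
    positivity
  exact mul_pos (Finset.prod_pos fun _ _ => hpos _) (hpos _)

theorem othersWeight_uniform_pos {D : DecPOMDP.{u}}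
    (μ : ∀ j, ProbabilityMeasure (D.LocalPolicy j)) (i : Fin D.N)
    (hμ : ∀ j ≠ i, (μ j : Measure (D.LocalPolicy j)) = Measure.dirac (uniformPolicy j))
    (t : Fin (D.T + 1)) (h : D.Hist t) (h0 : envWeight h ≠ 0) :
    0 < othersWeight μ i t (aoHist h i t le_rfl) (h.2.1 (Fin.last t) i) := by
  refine Finset.sum_pos' (fun h' _ => ?_) ⟨h, Finset.mem_univ h, ?_⟩
  · split_ifs
    · exact mul_nonneg (envWeight_nonneg _)
        (Finset.prod_nonneg fun _ _ => meanPlayActProb_nonneg _ _ _ _)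
    · exact le_rfl
  · rw [if_pos ⟨rfl, rfl⟩]
    refine mul_pos ((envWeight_nonneg h).lt_of_ne' h0) (Finset.prod_pos fun j hj => ?_)
    rw [meanPlayActProb, hμ j (Finset.ne_of_mem_erase hj),
      integral_dirac' _ _ (measurable_playActProb _ _ _).stronglyMeasurable]
    exact playActProb_uniformPolicy_pos _ _ _

theorem conditions_localMixture {D : DecPOMDP.{u}} (i : Fin D.N)
    (ν : ProbabilityMeasure (D.LocalPolicy i)) (h : D.Hist D.T) (h0 : envWeight h ≠ 0)
    (k : Fin (D.T + 1)) :
    Conditions (localMixture i ν) ν k (aoHist h i k (Nat.le_of_lt_succ k.2)) := by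
  classical
  intro hν a
  set τ := aoHist h i k (Nat.le_of_lt_succ k.2)
  have hex : ∃ μ : ∀ j, ProbabilityMeasure (D.LocalPolicy j),
      μ i = ν ∧ 0 < mixAOProb μ i k τ := by
    -- The other agents play uniformly, so they give positive probability to their part of any
    -- history; what remains is the environment weight, which is nonzero by `h0`.
    let δ : ∀ j, ProbabilityMeasure (D.LocalPolicy j) :=
      fun j => ⟨Measure.dirac (uniformPolicy j), inferInstance⟩
    refine ⟨Function.update δ i ν, Function.update_self .., ?_⟩
    rw [mixAOProb_eq _ i k τ (h.2.1 k i), Function.update_self]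
    refine mul_pos ((meanPlayProb_nonneg _ _ _ _).lt_of_ne' hν) ?_
    refine othersWeight_uniform_pos _ i (fun j hj => ?_) k
      (truncate h k (Nat.le_of_lt_succ k.2)) (envWeight_truncate_ne_zero h h0 _ _)
    rw [Function.update_of_ne hj]
    rfl
  rw [localMixture, dif_pos hex]
  have hμ := hex.choose_spec
  change mixAOActProb hex.choose i k τ a / mixAOProb hex.choose i k τ = _
  have hpos := hμ.2
  rw [mixAOProb_eq _ i k τ a] at hpos ⊢
  rw [mixAOActProb_eq, mul_div_mul_right _ _ (right_ne_zero_of_mul hpos.ne'), hμ.1]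

theorem J_localMixture {D : DecPOMDP.{u}} (ν : ∀ i, ProbabilityMeasure (D.LocalPolicy i)) :
    D.J (fun i => localMixture i (ν i)) =
      D.planValue fun i => meanPlayActProb (ν i) (Fin.last D.T) :=
  J_of_conditions _ ν fun h h0 _ _ => conditions_localMixture _ _ h h0 _

end DecPOMDP

/-! ### Finite averages -/

theorem expect_pi_prod {ι : Type*} [Fintype ι] [DecidableEq ι] {X : ι → Type*}
    [∀ i, Fintype (X i)] (F : ∀ i, X i → ℝ) :
    (Finset.expect Finset.univ fun x : ∀ i, X i => ∏ i, F i (x i)) =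
      ∏ i, Finset.expect Finset.univ (F i) := by
  simp only [Fintype.expect_eq_sum_div_card, Finset.prod_div_distrib]
  rw [Finset.prod_univ_sum, Fintype.piFinset_univ, Fintype.card_pi, Nat.cast_prod]

/-- Uniform choices in a product have uniform marginals: a special case of `expect_pi_prod` with all
other factors equal to one. -/
theorem expect_pi_eval {ι : Type*} [Fintype ι] [DecidableEq ι] {X : ι → Type*}
    [∀ i, Fintype (X i)] [∀ i, Nonempty (X i)] (i : ι) (F : X i → ℝ) :
    (Finset.expect Finset.univ fun x : ∀ i, X i => F (x i)) = Finset.expect Finset.univ F := by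
  have h := expect_pi_prod (Function.update (fun j (_ : X j) => (1 : ℝ)) i F)
  have hprod : ∀ x : ∀ j, X j,
      ∏ j, Function.update (fun j (_ : X j) => (1 : ℝ)) i F j (x j) = F (x i) := by
    intro x
    rw [Finset.prod_eq_single i (fun j _ hj => by rw [Function.update_of_ne hj]) (by simp),
      Function.update_self]
  simp only [hprod] at h
  rw [h, Finset.prod_eq_single i (fun j _ hj => ?_) (by simp), Function.update_self]
  rw [Function.update_of_ne hj, Fintype.expect_const]

theorem integral_expect {X ι : Type*} [MeasurableSpace X] [Fintype ι] (m : Measure X)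
    (F : ι → X → ℝ) (hF : ∀ i, Integrable (F i) m) :
    ∫ x, Finset.expect Finset.univ (fun i => F i x) ∂m =
      Finset.expect Finset.univ fun i => ∫ x, F i x ∂m := by
  simp only [Fintype.expect_eq_sum_div_card, integral_div]
  rw [integral_finsetSum _ fun i _ => hF i]

/-- The uniform mixture of a nonempty finite family of probability measures. -/
noncomputable def uniformMixture {X ι : Type*} [MeasurableSpace X] [Fintype ι] [Nonempty ι]
    (ν : ι → ProbabilityMeasure X) : ProbabilityMeasure X :=
  ⟨((Fintype.card ι : ℝ≥0∞)⁻¹) • ∑ i, (ν i : Measure X), ⟨by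
    simp only [Measure.smul_apply, Measure.coe_finsetSum, Finset.sum_apply, measure_univ,
      Finset.sum_const, Finset.card_univ, nsmul_eq_mul, mul_one, smul_eq_mul]
    exact ENNReal.inv_mul_cancel (Nat.cast_ne_zero.2 Fintype.card_ne_zero)
      (ENNReal.natCast_ne_top _)⟩⟩

theorem integral_uniformMixture {X ι : Type*} [MeasurableSpace X] [Fintype ι] [Nonempty ι]
    (ν : ι → ProbabilityMeasure X) (F : X → ℝ) (hF : ∀ i, Integrable F (ν i : Measure X)) :
    ∫ x, F x ∂(uniformMixture ν : Measure X) =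
      Finset.expect Finset.univ fun i => ∫ x, F x ∂(ν i : Measure X) := by
  change ∫ x, F x ∂(((Fintype.card ι : ℝ≥0∞)⁻¹) • ∑ i, (ν i : Measure X)) = _
  rw [integral_smul_measure, integral_finsetSum_measure fun i _ => hF i,
    Fintype.expect_eq_sum_div_card, ENNReal.toReal_inv, ENNReal.toReal_natCast, smul_eq_mul,
    inv_mul_eq_div]

/-! ### Averages of the return over independent choices -/

namespace DecPOMDP

theorem expect_planValue {D : DecPOMDP.{u}} {X : Fin D.N → Type*} [∀ i, Fintype (X i)]
    (y : ∀ i, X i → (Fin D.T → D.Act i × D.Obs i) → D.Act i → ℝ) :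
    (Finset.expect Finset.univ fun x : ∀ i, X i => D.planValue fun i => y i (x i)) =
      D.planValue fun i τ a => Finset.expect Finset.univ fun x : X i => y i x τ a := by
  unfold planValue
  rw [Finset.expect_sum_comm]
  refine Finset.sum_congr rfl fun h _ => ?_
  rw [← Finset.expect_mul, ← Finset.mul_expect,
    expect_pi_prod fun i (x : X i) => y i x (aoHist h i D.T le_rfl) (h.2.1 (Fin.last D.T) i)]

theorem integrable_J {D : DecPOMDP.{u}} (m : Measure D.Policy) [IsFiniteMeasure m] :
    Integrable D.J m := by
  unfold J
  exact integrable_finsetSum _ fun h _ => (integrable_histProb m _ _ h).mul_const _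

/-- The expected return when the local policies are drawn independently. -/
theorem integral_pi_J {D : DecPOMDP.{u}} (μ : Fin D.N → ProbabilityMeasure D.Policy) :
    ∫ π : Fin D.N → D.Policy, D.J (fun l => π l l)
        ∂(Measure.pi fun k => (μ k : Measure D.Policy)) =
      D.planValue fun i => meanPlayActProb
        ((μ i).map (measurable_pi_apply i).aemeasurable) (Fin.last D.T) := by
  set ν : ∀ i, ProbabilityMeasure (D.LocalPolicy i) :=
    fun i => (μ i).map (measurable_pi_apply i).aemeasurable
  have hmap : Measure.map (fun (π : Fin D.N → D.Policy) l => π l l)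
      (Measure.pi fun k => (μ k : Measure D.Policy)) =
      Measure.pi fun i => (ν i : Measure (D.LocalPolicy i)) := by
    have : ∀ i, SigmaFinite (((μ i : Measure D.Policy)).map
        (fun p : D.Policy => p i)) := fun i =>
      have := Measure.isProbabilityMeasure_map (μ := (μ i : Measure D.Policy))
        (measurable_pi_apply (X := D.LocalPolicy) i).aemeasurable
      inferInstance
    exact Measure.pi_map_pi (μ := fun k => (μ k : Measure D.Policy))
      (f := fun i (p : D.Policy) => p i) fun i => (measurable_pi_apply i).aemeasurable
  have hmeas : Measurable fun (π : Fin D.N → D.Policy) l => π l l :=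
    measurable_pi_lambda _ fun l => (measurable_pi_apply l).comp (measurable_pi_apply l)
  have h1 := integral_map (μ := Measure.pi fun k => (μ k : Measure D.Policy))
    hmeas.aemeasurable (integrable_J _).aestronglyMeasurable
  rw [← h1, hmap]
  unfold J planValue
  rw [integral_finsetSum _ fun h _ => (integrable_histProb _ _ _ h).mul_const _]
  refine Finset.sum_congr rfl fun h _ => ?_
  rw [integral_mul_const]
  congr 1
  exact integral_histProb ν (Fin.last D.T) h

/-! ### Composition and inversion of isomorphisms -/

namespace Iso

/-- Composition of isomorphisms. -/
def trans {D : DecPOMDP.{u}} {E : DecPOMDP.{v}} {F : DecPOMDP} (f : Iso D E) (g : Iso E F) :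
    Iso D F where
  agent := f.agent.trans g.agent
  state := f.state.trans g.state
  act := fun j => (f.act (g.agent.symm j)).trans (g.act j)
  obs := fun j => (f.obs (g.agent.symm j)).trans (g.obs j)
  horizon_eq := f.horizon_eq.trans g.horizon_eq
  map_P := fun s s' a => (f.map_P s s' a).trans (g.map_P _ _ _)
  map_O := fun s a o => (f.map_O s a o).trans (g.map_O _ _ _)
  map_R := fun s a => (f.map_R s a).trans (g.map_R _ _)
  map_b0 := fun s => (f.map_b0 s).trans (g.map_b0 _)

theorem trans_left_injective {D : DecPOMDP.{u}} {E : DecPOMDP.{v}} {F : DecPOMDP}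
    (g : Iso E F) : Function.Injective fun f : Iso D E => f.trans g := by
  rintro ⟨a, s, c, o, _, _, _, _, _⟩ ⟨a', s', c', o', _, _, _, _, _⟩ h
  obtain ⟨ha, hs, hc, ho⟩ := Iso.ext_iff.1 h
  obtain rfl : a = a' := Equiv.ext fun x => g.agent.injective (Equiv.congr_fun ha x)
  obtain rfl : s = s' := Equiv.ext fun x => g.state.injective (Equiv.congr_fun hs x)
  obtain rfl : c = c' := by
    funext j
    obtain ⟨k, rfl⟩ := g.agent.symm.surjective j
    exact Equiv.ext fun x =>
      (g.act k).injective (Equiv.congr_fun (congrFun (eq_of_heq hc) k) x)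
  obtain rfl : o = o' := by
    funext j
    obtain ⟨k, rfl⟩ := g.agent.symm.surjective j
    exact Equiv.ext fun x =>
      (g.obs k).injective (Equiv.congr_fun (congrFun (eq_of_heq ho) k) x)
  rfl

theorem trans_right_injective {D : DecPOMDP.{u}} {E : DecPOMDP.{v}} {F : DecPOMDP}
    (f : Iso D E) : Function.Injective fun g : Iso E F => f.trans g := by
  rintro ⟨a, s, c, o, _, _, _, _, _⟩ ⟨a', s', c', o', _, _, _, _, _⟩ h
  obtain ⟨ha, hs, hc, ho⟩ := Iso.ext_iff.1 h
  obtain rfl : a = a' := by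
    ext x
    obtain ⟨x, rfl⟩ := f.agent.surjective x
    exact congrArg Fin.val (Equiv.congr_fun ha x)
  obtain rfl : s = s' := by
    ext x
    obtain ⟨x, rfl⟩ := f.state.surjective x
    exact Equiv.congr_fun hs x
  obtain rfl : c = c' := by
    funext j
    ext x
    obtain ⟨x, rfl⟩ := (f.act _).surjective x
    exact Equiv.congr_fun (congrFun (eq_of_heq hc) j) x
  obtain rfl : o = o' := by
    funext j
    ext x
    obtain ⟨x, rfl⟩ := (f.obs _).surjective x
    exact Equiv.congr_fun (congrFun (eq_of_heq ho) j) x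
  rfl

/-- Handles the type transport from `e.symm (e i)` to `i` once and for all, so that the inverse
isomorphism preserves kernels and rewards. -/
theorem piCongr'_symm_eq {n m : ℕ} {X : Fin n → Type u} {Y : Fin m → Type v}
    (e : Fin n ≃ Fin m) (c : ∀ j, X (e.symm j) ≃ Y j) (y : ∀ j, Y j) :
    e.symm.piCongr' (fun i => (c (e i)).symm.trans
      (Equiv.cast (congrArg X (e.symm_apply_apply i)))) y = (e.piCongr' c).symm y := by
  rw [Equiv.eq_symm_apply]
  funext j
  -- With the index `k` free, the equality `k = j` can be eliminated and the cast disappears.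
  have key : ∀ (k : Fin m) (h : k = j) (h' : X (e.symm k) = X (e.symm j)),
      c j (cast h' ((c k).symm (y k))) = y j := by
    rintro k rfl h'
    simp
  exact key _ (e.apply_symm_apply j) _

/-- The inverse of an isomorphism. -/
def symm {D : DecPOMDP.{u}} {E : DecPOMDP.{v}} (f : Iso D E) : Iso E D where
  agent := f.agent.symm
  state := f.state.symm
  act := fun i => (f.act (f.agent i)).symm.trans
    (Equiv.cast (congrArg D.Act (f.agent.symm_apply_apply i)))
  obs := fun i => (f.obs (f.agent i)).symm.trans
    (Equiv.cast (congrArg D.Obs (f.agent.symm_apply_apply i)))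
  horizon_eq := f.horizon_eq.symm
  map_P := fun s s' a => by
    rw [f.map_P, piCongr'_symm_eq]
    simp only [Equiv.apply_symm_apply]
  map_O := fun s a o => by
    rw [f.map_O, piCongr'_symm_eq, piCongr'_symm_eq]
    simp only [Equiv.apply_symm_apply]
  map_R := fun s a => by
    rw [f.map_R, piCongr'_symm_eq]
    simp only [Equiv.apply_symm_apply]
  map_b0 := fun s => by
    rw [f.map_b0]
    simp only [Equiv.apply_symm_apply]

/-- The sets of isomorphisms are finite, and composition with `g` and with `g.symm` gives injections
both ways. Counting avoids verifying the groupoid laws. -/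
theorem trans_left_bijective {D : DecPOMDP.{u}} {E : DecPOMDP.{v}} {F : DecPOMDP}
    (g : Iso E F) : Function.Bijective fun f : Iso D E => f.trans g :=
  (Function.Injective.bijective_of_nat_card_le (trans_left_injective g)
    (Nat.card_le_card_of_injective _ (trans_left_injective g.symm)))

theorem trans_right_bijective {D : DecPOMDP.{u}} {E : DecPOMDP.{v}} {F : DecPOMDP}
    (f : Iso D E) : Function.Bijective fun g : Iso E F => f.trans g :=
  (Function.Injective.bijective_of_nat_card_le (trans_right_injective f)
    (Nat.card_le_card_of_injective _ (trans_right_injective f.symm)))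

end Iso

/-! ### Invariance of the expected return -/

/-- Isomorphic problems have horizons that are only propositionally equal; this lets both returns be
summed over histories of the same length. -/
theorem J_eq_sum_of_horizon {D : DecPOMDP.{u}} (π : D.Policy) (t : ℕ) (ht : D.T = t) :
    D.J π = ∑ h : D.Hist t, histProb π t ht.ge h *
      ∑ k : Fin (t + 1), D.R (h.1 k) (h.2.1 k) := by
  subst ht
  rfl

/-- The action of an isomorphism on histories. -/
def histEquiv {D : DecPOMDP.{u}} {E : DecPOMDP.{v}} (f : Iso D E) (t : ℕ) :
    D.Hist t ≃ E.Hist t :=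
  ((Equiv.refl (Fin (t + 1))).arrowCongr f.state).prodCongr
    (((Equiv.refl (Fin (t + 1))).arrowCongr (f.agent.piCongr' f.act)).prodCongr
      ((Equiv.refl (Fin t)).arrowCongr (f.agent.piCongr' f.obs)))

theorem histProb_push {D : DecPOMDP.{u}} {E : DecPOMDP.{v}} (f : Iso D E) (π : D.Policy) (t : ℕ)
    (ht : t ≤ D.T) (ht' : t ≤ E.T) (h : D.Hist t) :
    histProb (push f π) t ht' (histEquiv f t h) = histProb π t ht h := by
  unfold histProb
  congr 1
  · congr 1
    · exact (f.map_b0 _).symm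
    · refine Finset.prod_congr rfl fun k _ => ?_
      rw [f.map_P, f.map_O]
      rfl
  · refine Finset.prod_congr rfl fun k _ => ?_
    refine Fintype.prod_equiv f.agent.symm _ _ fun j => ?_
    change π (f.agent.symm j) ⟨k, by omega⟩ (fun l => ((f.act j).symm (f.act j _),
      (f.obs j).symm (f.obs j _))) ((f.act j).symm (f.act j _)) = _
    simp only [Equiv.symm_apply_apply]
    rfl

theorem J_push {D : DecPOMDP.{u}} {E : DecPOMDP.{v}} (f : Iso D E) (π : D.Policy) :
    E.J (push f π) = D.J π := by
  rw [J_eq_sum_of_horizon (push f π) D.T f.horizon_eq.symm, J]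
  refine (Fintype.sum_equiv (histEquiv f D.T) _ _ fun h => ?_).symm
  rw [histProb_push f π D.T le_rfl]
  congr 1
  exact Finset.sum_congr rfl fun k _ => f.map_R _ _

/-! ### The expected return under independently randomized automorphisms -/

/-- The other-play return when agent `k` uses its part of the policy `ρ k`. -/
noncomputable def crossOP (D : DecPOMDP.{u}) (ρ : Fin D.N → D.Policy) : ℝ :=
  Finset.expect Finset.univ fun g : Fin D.N → D.Aut => D.J fun k => push (g k) (ρ k) k

theorem crossOP_const {D : DecPOMDP.{u}} (π : D.Policy) : D.crossOP (fun _ => π) = D.JOP π := rfl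

theorem integral_opDist_marginal {D : DecPOMDP.{u}} (π : D.Policy) (i : Fin D.N)
    (t : Fin (D.T + 1)) (τ : Fin (t : ℕ) → D.Act i × D.Obs i) (a : D.Act i) :
    meanPlayActProb ((opDist π).map (measurable_pi_apply i).aemeasurable) t τ a =
      Finset.expect Finset.univ fun g : D.Aut => playActProb (push g π i) t τ a := by
  have hm : Measurable fun p : D.Policy => playActProb (p i) t τ a :=
    (measurable_playActProb t τ a).comp (measurable_pi_apply i)
  rw [meanPlayActProb, ProbabilityMeasure.toMeasure_map,
    integral_map (measurable_pi_apply i).aemeasurable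
      (measurable_playActProb t τ a).aestronglyMeasurable]
  change ∫ p : D.Policy, playActProb (p i) t τ a ∂(((Fintype.card (Fin D.N → D.Aut) : ℝ≥0∞)⁻¹) •
      ∑ g : Fin D.N → D.Aut, Measure.dirac (profilePush g π)) = _
  rw [integral_smul_measure, integral_finsetSum_measure]
  · simp only [fun g : Fin D.N → D.Aut =>
      integral_dirac' (fun p : D.Policy => playActProb (p i) t τ a) (profilePush g π)
        hm.stronglyMeasurable]
    rw [← expect_pi_eval (X := fun _ : Fin D.N => D.Aut) i fun g => playActProb (push g π i) t τ a,
      Fintype.expect_eq_sum_div_card, ENNReal.toReal_inv, ENNReal.toReal_natCast, smul_eq_mul,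
      inv_mul_eq_div]
    rfl
  · intro g _
    refine Integrable.of_bound hm.aestronglyMeasurable 1 (Filter.Eventually.of_forall fun p => ?_)
    rw [Real.norm_of_nonneg (playActProb_nonneg _ t τ a)]
    exact playActProb_le_one _ t τ a

/-- The automorphisms are independent across agents, so by multilinearity their average passes to
each agent's weight. There it is the mean weight under the marginal of the OP distribution, which
the symmetrizer realizes. -/
theorem crossOP_eq_J_symmetrizer {D : DecPOMDP.{u}} (ρ : Fin D.N → D.Policy) :
    D.crossOP ρ = D.J fun k => symmetrizer (ρ k) k := by
  unfold symmetrizer crossOP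
  rw [J_localMixture]
  simp only [J_eq_planValue]
  rw [expect_planValue fun i (g : D.Aut) => playActProb (push g (ρ i) i) (Fin.last D.T)]
  congr 1
  funext i τ a
  rw [integral_opDist_marginal]

/-- Composition with `f`, after it or before it, turns uniform automorphisms of `E` or of `D` into
uniform isomorphisms from `D` to `E`. Both sides become the same average over these. -/
theorem crossOP_push {D : DecPOMDP.{u}} {E : DecPOMDP.{v}} (f : Iso D E)
    (ρ : Fin D.N → D.Policy) :
    E.crossOP (fun j => push f (ρ (f.agent.symm j))) = D.crossOP ρ := by
  have h1 : E.crossOP (fun j => push f (ρ (f.agent.symm j))) =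
      Finset.expect Finset.univ fun h : Fin E.N → Iso D E =>
        E.J fun j => push (h j) (ρ (f.agent.symm j)) j :=
    Fintype.expect_bijective (fun (g : Fin E.N → E.Aut) j => f.trans (g j))
      (Function.Bijective.piMap fun _ => Iso.trans_right_bijective f) _ _ fun g => rfl
  have h2 : D.crossOP ρ = Finset.expect Finset.univ fun h : Fin E.N → Iso D E =>
        E.J fun j => push (h j) (ρ (f.agent.symm j)) j := by
    refine Fintype.expect_bijective (fun (g : Fin D.N → D.Aut) j => (g (f.agent.symm j)).trans f)
      ?_ _ _ fun g => ?_
    · exact (Function.Bijective.piMap (f := fun _ : Fin E.N => fun g : D.Aut => g.trans f)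
        fun _ => Iso.trans_left_bijective f).comp
        (f.agent.symm.arrowCongr (Equiv.refl D.Aut)).symm.bijective
    · rw [← J_push f]
      rfl
  rw [h1, h2]

theorem JOP_push {D : DecPOMDP.{u}} {E : DecPOMDP.{v}} (f : Iso D E) (π : D.Policy) :
    E.JOP (push f π) = D.JOP π :=
  crossOP_push f fun _ => π

theorem push_mem_opOptimal {D : DecPOMDP.{u}} {E : DecPOMDP.{v}} (f : Iso D E) {π : D.Policy}
    (hπ : π ∈ D.opOptimal) : push f π ∈ E.opOptimal := by
  intro π'
  rw [JOP_push, ← JOP_push f.symm]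
  exact hπ _

/-! ### Relabeled problems -/

instance (D : DecPOMDP.{u}) : Nonempty D.Labeling :=
  ⟨{ agent := Equiv.refl _, state := Fintype.equivFin _, act := fun _ => Fintype.equivFin _,
     obs := fun _ => Fintype.equivFin _ }⟩

instance (D : DecPOMDP.{u}) : Nonempty D.relabelings :=
  (Set.range_nonempty D.relabel).to_subtype

/-- A labeling is an isomorphism onto the relabeled problem. -/
def Labeling.toIso {D : DecPOMDP.{u}} (f : D.Labeling) : Iso D (D.relabel f) where
  agent := f.agent
  state := f.state
  act := fun i => f.act (f.agent.symm i)
  obs := fun i => f.obs (f.agent.symm i)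
  horizon_eq := rfl
  map_P := fun s s' a => by
    change _ = D.P (f.state.symm (f.state s)) (f.jointAct.symm (f.jointAct a))
      (f.state.symm (f.state s'))
    simp only [Equiv.symm_apply_apply]
  map_O := fun s a o => by
    change _ = D.O (f.state.symm (f.state s)) (f.jointAct.symm (f.jointAct a))
      (f.jointObs.symm (f.jointObs o))
    simp only [Equiv.symm_apply_apply]
  map_R := fun s a => by
    change _ = D.R (f.state.symm (f.state s)) (f.jointAct.symm (f.jointAct a))
    simp only [Equiv.symm_apply_apply]
  map_b0 := fun s => by
    change _ = D.b0 (f.state.symm (f.state s))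
    simp only [Equiv.symm_apply_apply]

instance {D : DecPOMDP.{u}} (E : D.relabelings) : Nonempty (Iso E.1 D) := by
  obtain ⟨_, f, rfl⟩ := E
  exact ⟨f.toIso.symm⟩

/-! ### The payoff of a profile -/

/-- The distribution over joint policies in `D` induced by a principal that uses `σ`. -/
noncomputable def principalDist {D : DecPOMDP.{u}} (σ : LearningAlg D.relabelings) :
    ProbabilityMeasure D.Policy :=
  uniformMixture fun E : D.relabelings => uniformMixture fun f : Iso E.1 D => pushDist f (σ E)

theorem integral_principalDist {D : DecPOMDP.{u}} (σ : LearningAlg D.relabelings)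
    {F : D.Policy → ℝ} (hF : Measurable F) (hb : ∀ p, ‖F p‖ ≤ 1) :
    ∫ p, F p ∂(principalDist σ : Measure D.Policy) =
      Finset.expect Finset.univ fun E : D.relabelings =>
        Finset.expect Finset.univ fun f : Iso E.1 D =>
          ∫ p, F p ∂(pushDist f (σ E) : Measure D.Policy) := by
  have hint : ∀ m : ProbabilityMeasure D.Policy, Integrable F (m : Measure D.Policy) := fun m =>
    Integrable.of_bound hF.aestronglyMeasurable 1 (Filter.Eventually.of_forall hb)
  rw [principalDist, integral_uniformMixture _ _ fun _ => hint _]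
  exact Finset.expect_congr rfl fun E _ => integral_uniformMixture _ _ fun _ => hint _

theorem integral_pushDist {D : DecPOMDP.{u}} {E : DecPOMDP.{v}} (f : Iso D E)
    (ν : ProbabilityMeasure D.Policy) {F : E.Policy → ℝ} (hF : Measurable F) :
    ∫ p, F p ∂(pushDist f ν : Measure E.Policy) =
      ∫ p, F (push f p) ∂(ν : Measure D.Policy) := by
  rw [pushDist, ProbabilityMeasure.toMeasure_map,
    integral_map (measurable_push f).aemeasurable hF.aestronglyMeasurable]

/-- The automorphism is absorbed by the uniformly random isomorphism to `D`. -/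
theorem integral_principalDist_push {D : DecPOMDP.{u}} (σ : LearningAlg D.relabelings)
    (g : D.Aut) {F : D.Policy → ℝ} (hF : Measurable F) (hb : ∀ p, ‖F p‖ ≤ 1) :
    ∫ p, F (push g p) ∂(principalDist σ : Measure D.Policy) =
      ∫ p, F p ∂(principalDist σ : Measure D.Policy) := by
  have hFg : Measurable fun p => F (push g p) := hF.comp (measurable_push g)
  rw [integral_principalDist σ hF hb, integral_principalDist σ hFg fun p => hb _]
  refine Finset.expect_congr rfl fun E _ => ?_
  refine Fintype.expect_bijective (fun f => f.trans g) (Iso.trans_left_bijective g) _ _ fun f => ?_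
  rw [integral_pushDist _ _ hF, integral_pushDist _ _ hFg]
  rfl

/-- The distribution over local policies of agent `i` induced by principal `i`. -/
noncomputable def localDist {D : DecPOMDP.{u}} (σ : Fin D.N → LearningAlg D.relabelings)
    (i : Fin D.N) : ProbabilityMeasure (D.LocalPolicy i) :=
  (principalDist (σ i)).map (measurable_pi_apply i).aemeasurable

theorem meanPlayActProb_map {D : DecPOMDP.{u}} (ν : ProbabilityMeasure D.Policy) (i : Fin D.N)
    (t : Fin (D.T + 1)) (τ : Fin (t : ℕ) → D.Act i × D.Obs i) (a : D.Act i) :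
    meanPlayActProb (ν.map (measurable_pi_apply i).aemeasurable) t τ a =
      ∫ p, playActProb (p i) t τ a ∂(ν : Measure D.Policy) := by
  rw [meanPlayActProb, ProbabilityMeasure.toMeasure_map,
    integral_map (measurable_pi_apply i).aemeasurable
      (measurable_playActProb t τ a).aestronglyMeasurable]

theorem meanPlayProb_map {D : DecPOMDP.{u}} (ν : ProbabilityMeasure D.Policy) (i : Fin D.N)
    (t : ℕ) (ht : t ≤ D.T + 1) (τ : Fin t → D.Act i × D.Obs i) :
    meanPlayProb (ν.map (measurable_pi_apply i).aemeasurable) t ht τ =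
      ∫ p, playProb (p i) t ht τ ∂(ν : Measure D.Policy) := by
  rw [meanPlayProb, ProbabilityMeasure.toMeasure_map,
    integral_map (measurable_pi_apply i).aemeasurable
      (measurable_playProb t ht τ).aestronglyMeasurable]

theorem norm_playActProb_le_one {D : DecPOMDP.{u}} {i : Fin D.N} (p : D.LocalPolicy i)
    (t : Fin (D.T + 1)) (τ : Fin (t : ℕ) → D.Act i × D.Obs i) (a : D.Act i) :
    ‖playActProb p t τ a‖ ≤ 1 := by
  rw [Real.norm_of_nonneg (playActProb_nonneg p t τ a)]
  exact playActProb_le_one p t τ a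

theorem norm_playProb_le_one {D : DecPOMDP.{u}} {i : Fin D.N} (p : D.LocalPolicy i) (t : ℕ)
    (ht : t ≤ D.T + 1) (τ : Fin t → D.Act i × D.Obs i) : ‖playProb p t ht τ‖ ≤ 1 := by
  rw [Real.norm_of_nonneg (playProb_nonneg p t ht τ)]
  exact playProb_le_one p t ht τ

/-- Principals draw problems, isomorphisms and policies independently, so multilinearity replaces
each by its mean weights, which its behavioral policy realizes. -/
theorem payoff_eq_J_behavioral {D : DecPOMDP.{u}} (σ : Fin D.N → LearningAlg D.relabelings) :
    D.payoff σ = D.J fun i => behavioral (localDist σ i) := by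
  rw [J_behavioral, payoff]
  simp only [integral_pi_J]
  have hinner : ∀ Ds : Fin D.N → D.relabelings,
      (Finset.expect Finset.univ fun f : ((j : Fin D.N) → Iso (Ds j).1 D) =>
        D.planValue fun i => meanPlayActProb ((pushDist (f i) (σ i (Ds i))).map
          (measurable_pi_apply i).aemeasurable) (Fin.last D.T)) =
      D.planValue fun i τ a => Finset.expect Finset.univ fun f : Iso (Ds i).1 D =>
        meanPlayActProb ((pushDist f (σ i (Ds i))).map
          (measurable_pi_apply i).aemeasurable) (Fin.last D.T) τ a := fun Ds =>
    expect_planValue (X := fun i => Iso (Ds i).1 D) fun i f =>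
      meanPlayActProb ((pushDist f (σ i (Ds i))).map
          (measurable_pi_apply i).aemeasurable) (Fin.last D.T)
  simp only [hinner]
  rw [expect_planValue (X := fun _ => D.relabelings) fun i E τ a =>
    Finset.expect Finset.univ fun f : Iso E.1 D =>
        meanPlayActProb ((pushDist f (σ i E)).map
          (measurable_pi_apply i).aemeasurable) (Fin.last D.T) τ a]
  congr 1
  funext i τ a
  simp only [localDist, meanPlayActProb_map]
  exact (integral_principalDist (σ i)
    ((measurable_playActProb _ _ _).comp (measurable_pi_apply i))
    fun p => norm_playActProb_le_one _ _ _ _).symm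

/-! ### Symmetric profiles and the upper bound -/

theorem meanPlayProb_localDist {D : DecPOMDP.{u}} {σ : Fin D.N → LearningAlg D.relabelings}
    (hσ : D.IsSymmetricProfile σ) (g : D.Aut) (i : Fin D.N) (t : ℕ) (ht : t ≤ D.T + 1)
    (τ : Fin t → D.Act i × D.Obs i) :
    meanPlayProb (localDist σ (g.agent.symm i)) t ht
        (fun l => ((g.act i).symm (τ l).1, (g.obs i).symm (τ l).2)) =
      meanPlayProb (localDist σ i) t ht τ := by
  simp only [localDist, meanPlayProb_map, ← hσ g i]
  exact integral_principalDist_push (σ i) g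
    ((measurable_playProb t ht τ).comp (measurable_pi_apply i))
    fun p => norm_playProb_le_one _ t ht τ

theorem meanPlayActProb_localDist {D : DecPOMDP.{u}} {σ : Fin D.N → LearningAlg D.relabelings}
    (hσ : D.IsSymmetricProfile σ) (g : D.Aut) (i : Fin D.N) (t : Fin (D.T + 1))
    (τ : Fin (t : ℕ) → D.Act i × D.Obs i) (a : D.Act i) :
    meanPlayActProb (localDist σ (g.agent.symm i)) t
        (fun l => ((g.act i).symm (τ l).1, (g.obs i).symm (τ l).2)) ((g.act i).symm a) =
      meanPlayActProb (localDist σ i) t τ a := by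
  simp only [localDist, meanPlayActProb_map, ← hσ g i]
  exact integral_principalDist_push (σ i) g
    ((measurable_playActProb t τ a).comp (measurable_pi_apply i))
    fun p => norm_playActProb_le_one _ _ _ _

/-- `behavioral` is given by a formula in the mean weights at every local history. Symmetry of the
profile is needed because `g` may move agent `i` to another agent, whose principal must then use the
same algorithm. -/
theorem push_behavioral_localDist {D : DecPOMDP.{u}} {σ : Fin D.N → LearningAlg D.relabelings}
    (hσ : D.IsSymmetricProfile σ) (g : D.Aut) :
    push g (fun i => behavioral (localDist σ i)) = fun i => behavioral (localDist σ i) := by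
  funext i t τ
  refine Subtype.ext (funext fun a => ?_)
  change behavioral (localDist σ (g.agent.symm i)) t
    (fun l => ((g.act i).symm (τ l).1, (g.obs i).symm (τ l).2)) ((g.act i).symm a) =
    behavioral (localDist σ i) t τ a
  unfold behavioral
  have hx := meanPlayProb_localDist hσ g i t t.2.le τ
  by_cases h0 : meanPlayProb (localDist σ i) t t.2.le τ = 0
  · rw [dif_pos h0, dif_pos (hx.trans h0)]
    -- Where the formula does not apply the default is uniform, which any bijection of action sets
    -- preserves.
    change (Fintype.card (D.Act (g.agent.symm i)) : ℝ)⁻¹ = (Fintype.card (D.Act i) : ℝ)⁻¹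
    rw [Fintype.card_congr (g.act i)]
  · rw [dif_neg h0, dif_neg fun h => h0 (hx.symm.trans h)]
    exact congrArg₂ (· / ·) (meanPlayActProb_localDist hσ g i t τ a) hx

theorem payoff_eq_JOP_behavioral {D : DecPOMDP.{u}} {σ : Fin D.N → LearningAlg D.relabelings}
    (hσ : D.IsSymmetricProfile σ) :
    D.payoff σ = D.JOP fun i => behavioral (localDist σ i) := by
  have h : ∀ g : Fin D.N → D.Aut, profilePush g (fun i => behavioral (localDist σ i)) =
      fun i => behavioral (localDist σ i) := fun g => by
    funext i
    exact congrFun (push_behavioral_localDist hσ (g i)) i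
  rw [payoff_eq_J_behavioral]
  simp only [JOP, h, Fintype.expect_const]

/-- The payoff as an average of other-play returns. -/
theorem payoff_eq_crossOP {D : DecPOMDP.{u}} (σ : Fin D.N → LearningAlg D.relabelings) :
    D.payoff σ = Finset.expect Finset.univ fun Ds : Fin D.N → D.relabelings =>
      Finset.expect Finset.univ fun f : ((j : Fin D.N) → Iso (Ds j).1 D) =>
        ∫ π : ∀ k, (Ds k).1.Policy, D.crossOP (fun k => push (f k) (π k))
          ∂(Measure.pi fun k => (σ k (Ds k) : Measure (Ds k).1.Policy)) := by
  refine Finset.expect_congr rfl fun Ds _ => ?_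
  have hmeas : ∀ f : (j : Fin D.N) → Iso (Ds j).1 D,
      Measurable fun (π : ∀ k, (Ds k).1.Policy) l => push (f l) (π l) l := fun f =>
    measurable_pi_lambda _ fun l =>
      (measurable_pi_apply l).comp ((measurable_push (f l)).comp (measurable_pi_apply l))
  set m := Measure.pi fun k => (σ k (Ds k) : Measure (Ds k).1.Policy)
  have hint : ∀ f : (j : Fin D.N) → Iso (Ds j).1 D,
      Integrable (fun π : ∀ k, (Ds k).1.Policy => D.J fun l => push (f l) (π l) l) m := fun f =>
    (integrable_J (m.map _)).comp_measurable (hmeas f)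
  have hpush : ∀ f : (j : Fin D.N) → Iso (Ds j).1 D,
      ∫ π : Fin D.N → D.Policy, D.J (fun l => π l l)
        ∂(Measure.pi fun k => (pushDist (f k) (σ k (Ds k)) : Measure D.Policy)) =
      ∫ π : ∀ k, (Ds k).1.Policy, D.J (fun l => push (f l) (π l) l) ∂m := by
    intro f
    have hmap : Measure.map (fun (π : ∀ k, (Ds k).1.Policy) k => push (f k) (π k)) m =
        Measure.pi fun k => (pushDist (f k) (σ k (Ds k)) : Measure D.Policy) := by
      have : ∀ k, SigmaFinite ((σ k (Ds k) : Measure (Ds k).1.Policy).map (push (f k))) :=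
        fun k =>
          have := Measure.isProbabilityMeasure_map (μ := (σ k (Ds k) : Measure (Ds k).1.Policy))
            (measurable_push (f k)).aemeasurable
          inferInstance
      exact Measure.pi_map_pi fun k => (measurable_push (f k)).aemeasurable
    rw [← hmap, integral_map]
    · exact (measurable_pi_lambda _ fun k =>
        (measurable_push (f k)).comp (measurable_pi_apply k)).aemeasurable
    · have hd : Measurable fun (π : Fin D.N → D.Policy) l => π l l :=
        measurable_pi_lambda _ fun l => (measurable_pi_apply l).comp (measurable_pi_apply l)
      rw [hmap]
      exact ((integrable_J (Measure.map _ _)).comp_measurable hd).aestronglyMeasurable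
  simp only [hpush, crossOP]
  have hswap : ∀ f : (j : Fin D.N) → Iso (Ds j).1 D,
      ∫ π : ∀ k, (Ds k).1.Policy, Finset.expect Finset.univ (fun g : Fin D.N → D.Aut =>
        D.J fun k => push (g k) (push (f k) (π k)) k) ∂m =
      Finset.expect Finset.univ fun g : Fin D.N → D.Aut =>
        ∫ π : ∀ k, (Ds k).1.Policy, D.J (fun k => push (g k) (push (f k) (π k)) k) ∂m :=
    fun f => integral_expect m _ fun g => hint fun k => (f k).trans (g k)
  simp only [hswap]
  -- For each fixed `g`, the substitution of `f k` followed by `g k` for `f k` permutes the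
  -- isomorphism profiles, so the inner average does not depend on `g`.
  rw [Finset.expect_comm]
  refine ((Finset.expect_congr rfl fun g _ => ?_).trans (Fintype.expect_const _)).symm
  exact Fintype.expect_bijective
    (fun (f : (j : Fin D.N) → Iso (Ds j).1 D) k => (f k).trans (g k))
    (Function.Bijective.piMap fun k => Iso.trans_left_bijective (g k)) _ _ fun f => rfl

/-! ### Other-play with tie-breaking -/

/-- Policies in isomorphic problems that maximize an invariant tie-breaking function among the
OP-optimal policies are equivalent. -/
theorem symmetrizer_push_eq {C : Set DecPOMDP.{u}} {χ : (E : C) → E.1.Policy → Set.Icc (0 : ℝ) 1}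
    (hχ : IsTieBreaking C χ) (hχ_inv : IsIsoInvariant C χ) {E F : C} (f : Iso E.1 F.1)
    {π : E.1.Policy} {ρ : F.1.Policy} (hπ : π ∈ E.1.opOptimal)
    (hπ_max : IsMaxOn (χ E) E.1.opOptimal π) (hρ : ρ ∈ F.1.opOptimal)
    (hρ_max : IsMaxOn (χ F) F.1.opOptimal ρ) :
    symmetrizer (push f π) = symmetrizer ρ := by
  have h1 : χ E π = χ F (push f π) := hχ_inv E F f π _ rfl
  have h2 : χ F ρ = χ E (push f.symm ρ) := hχ_inv F E f.symm ρ _ rfl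
  -- Transport along `f` and back shows that the two maximal values of `χ` agree; equal values mean
  -- equal symmetrizers.
  refine hχ.2 F _ _ (le_antisymm (hρ_max (push_mem_opOptimal f hπ)) ?_)
  rw [h2, ← h1]
  exact hπ_max (push_mem_opOptimal f.symm hρ)

/-- The integrand in `payoff_eq_crossOP` is almost surely constant: whatever problems, isomorphisms
and maximizers the principals draw, transport to `E` gives every agent the symmetrizer of `π₀`. -/
theorem payoff_opWithTieBreaking {D : DecPOMDP.{u}}
    {χ : (E : D.relabelings) → E.1.Policy → Set.Icc (0 : ℝ) 1}
    (hχ : IsTieBreaking D.relabelings χ) (hχ_inv : IsIsoInvariant D.relabelings χ)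
    {σ : LearningAlg D.relabelings} (hσ : IsOPWithTieBreaking D.relabelings χ σ)
    {E : D.relabelings} (r : Iso D E.1) {π₀ : E.1.Policy} (hπ₀ : π₀ ∈ E.1.opOptimal)
    (hmax : IsMaxOn (χ E) E.1.opOptimal π₀) :
    D.payoff (fun _ => σ) = E.1.JOP π₀ := by
  rw [payoff_eq_crossOP]
  have hconst : ∀ (Ds : Fin D.N → D.relabelings) (f : (j : Fin D.N) → Iso (Ds j).1 D),
      ∫ π : ∀ k, (Ds k).1.Policy, D.crossOP (fun k => push (f k) (π k))
        ∂(Measure.pi fun k => (σ (Ds k) : Measure (Ds k).1.Policy)) = E.1.JOP π₀ := by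
    intro Ds f
    have hae : ∀ᵐ π : ∀ k, (Ds k).1.Policy
        ∂(Measure.pi fun k => (σ (Ds k) : Measure (Ds k).1.Policy)),
        D.crossOP (fun k => push (f k) (π k)) = E.1.JOP π₀ := by
      have hall : ∀ k, ∀ᵐ p ∂(σ (Ds k) : Measure (Ds k).1.Policy),
          p ∈ (Ds k).1.opOptimal ∧ IsMaxOn (χ (Ds k)) (Ds k).1.opOptimal p := by
        intro k
        obtain ⟨Z, hZ, hZopt, hZ1, hZmax⟩ := hσ (Ds k)
        filter_upwards [(mem_ae_iff_prob_eq_one hZ).2 hZ1] with p hp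
        exact ⟨hZopt hp, hZmax p hp⟩
      filter_upwards [Filter.eventually_all.2 fun k =>
        (Measure.tendsto_eval_ae_ae (μ := fun k => (σ (Ds k) : Measure (Ds k).1.Policy))
          (i := k)).eventually (hall k)] with π hπ
      -- After transport along `r`, both sides are returns in `E` of joint policies assembled from
      -- symmetrizers, to be compared agent by agent.
      rw [← crossOP_push r, ← crossOP_const, crossOP_eq_J_symmetrizer, crossOP_eq_J_symmetrizer]
      congr 1
      funext j
      have hj := hπ (r.agent.symm j)
      rw [← symmetrizer_push_eq hχ hχ_inv ((f (r.agent.symm j)).trans r) hj.1 hj.2 hπ₀ hmax]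
      rfl
    rw [integral_congr_ae hae]
    simp
  simp only [hconst, Fintype.expect_const]

end DecPOMDP

/-! ### Optimality of other-play with tie-breaking -/

theorem mainTheorem1 (D : DecPOMDP.{u})
    (χ : (E : D.relabelings) → E.1.Policy → Set.Icc (0 : ℝ) 1)
    (hχ : DecPOMDP.IsTieBreaking D.relabelings χ)
    (hχ_inv : DecPOMDP.IsIsoInvariant D.relabelings χ)
    (σχ : DecPOMDP.LearningAlg D.relabelings)
    (hσχ : DecPOMDP.IsOPWithTieBreaking D.relabelings χ σχ) :
    D.IsOptimalSymmetricProfile (fun _ => σχ) ∧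
    D.IsLFCOptimal σχ ∧
    IsGreatest (Set.range D.lfcValue) (D.lfcValue σχ) ∧
    IsGreatest (Set.range D.JOP) (D.lfcValue σχ) := by
  obtain ⟨L⟩ : Nonempty D.Labeling := inferInstance
  -- The function `χ` is defined only on relabeled problems, and `D` itself need not be one.
  -- Maximizers are therefore taken in some relabeled `E` and carried back along `r`.
  let E : D.relabelings := ⟨D.relabel L, L, rfl⟩
  have r : DecPOMDP.Iso D E.1 := L.toIso
  obtain ⟨π₀, hπ₀, hmax⟩ := hχ.1 E
  have hval : D.payoff (fun _ => σχ) = E.1.JOP π₀ :=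
    DecPOMDP.payoff_opWithTieBreaking hχ hχ_inv hσχ r hπ₀ hmax
  have hbound : ∀ π : D.Policy, D.JOP π ≤ D.payoff fun _ => σχ := fun π => by
    rw [hval, ← DecPOMDP.JOP_push r]
    exact hπ₀ _
  have hsym : ∀ σ' : Fin D.N → DecPOMDP.LearningAlg D.relabelings, D.IsSymmetricProfile σ' →
      D.payoff σ' ≤ D.payoff fun _ => σχ := fun σ' hσ' => by
    rw [DecPOMDP.payoff_eq_JOP_behavioral hσ']
    exact hbound _
  have hopt : D.IsLFCOptimal σχ := fun σ' => hsym _ fun _ _ => rfl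
  refine ⟨⟨fun _ _ => rfl, hsym⟩, hopt, ⟨⟨σχ, rfl⟩, ?_⟩, ⟨⟨DecPOMDP.push r.symm π₀, ?_⟩, ?_⟩⟩
  · rintro _ ⟨σ', rfl⟩
    exact hopt σ'
  · rw [DecPOMDP.JOP_push]
    exact hval.symm
  · rintro _ ⟨π, rfl⟩
    exact hbound π
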